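/- **Theorem 3.6.** All matroids and graphs are finite; graphs may have loops and parallel edges. A *coloring* of a matroid $\mathcal M=(S,\mathcal I)$ is an assignment of colors to the elements of $S$; it is *1-courteous* if, for every color, deleting all elements of that color does not change the rank of $\mathcal M$. A matroid is *bridgeless* if its dual $\mathcal M^*$ has no circuit of size 1. A graph is *2-edge-connected* if it has at least two vertices and any two distinct vertices are joined by at least 2 pairwise edge-disjoint paths, or if it has exactly one vertex and at least 2 loops. A graph is *connected* if it has a vertex and any two vertices are joined by a path. An edge-coloring of a graph is *edge-1-color-avoiding connected* if the graph itself is connected and, for every color, the graph is still connected after the removal of all edges of that color. Programs are run on a random access machine on natural numbers, with finitely many registers and arrays, where every elementary step (constant, register or array access, addition, truncated subtraction, comparison, assignment, test of a branch or loop) has unit cost. An independence oracle for $\mathcal M$, with $S$ numbered $0,\dots,n-1$ in an arbitrary way, tells whether a set $X\subseteq S$, passed as a characteristic vector in an array, is independent; a call is charged with the evaluation of its length argument, one step, and one step for each cell of the vector. 1. There are one program with an independence oracle and one polynomial $T$ such that for every bridgeless matroid $\mathcal M$ on $n$ elements, the program, given only $n$ and the oracle, halts after at most $T(n)$ steps and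 outputs a 1-courteous coloring of $\mathcal M$ that uses the minimum number of colors among all 1-courteous colorings of $\mathcal M$. 2. In particular, there are one program that uses no oracle and one polynomial $T$ such that for every 2-edge-connected graph $G$ with $n$ vertices and $m$ edges, the program, given $n$, $m$ and the list of the pairs of ends of the edges, halts after at most $T(n+m)$ steps and outputs an edge-1-color-avoiding connected coloring of $G$ that uses the minimum number of colors among all edge-1-color-avoiding connected colorings of $G$. -/

import Mathlib

/-!
# Machine model, courteous colorings of matroids, color-avoiding connected colorings of graphs
-/

namespace Courteous

/-! ## A random access machine with a set oracle and a step count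

Programs are finite, access finitely many registers and arrays, and work with natural numbers.
Elementary operations have unit cost. There is no multiplication, so that in `t` steps the bit
length of the numbers in the memory grows by at most `O(t)`; hence polynomial time in this model
is polynomial time on a Turing machine (with the same oracle). -/

/-- Expressions: constants, registers, array cells, sum, truncated difference, and the tests
`<` and `=`, which have the value `1` for true and `0` for false. -/
inductive Expr where
  | const (k : ℕ)
  | var (x : ℕ)
  | read (a : ℕ) (i : Expr)
  | add (e₁ e₂ : Expr)
  | sub (e₁ e₂ : Expr)
  | lt (e₁ e₂ : Expr)
  | eq (e₁ e₂ : Expr)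

/-- The memory: `var x` is the content of register `x`, and `arr a i` is the content of cell `i`
of array `a`. -/
structure Memory where
  var : ℕ → ℕ
  arr : ℕ → ℕ → ℕ

/-- The value of an expression. -/
def Expr.eval (s : Memory) : Expr → ℕ
  | .const k => k
  | .var x => s.var x
  | .read a i => s.arr a (i.eval s)
  | .add e₁ e₂ => e₁.eval s + e₂.eval s
  | .sub e₁ e₂ => e₁.eval s - e₂.eval s
  | .lt e₁ e₂ => if e₁.eval s < e₂.eval s then 1 else 0
  | .eq e₁ e₂ => if e₁.eval s = e₂.eval s then 1 else 0

/-- The number of steps that the evaluation of an expression takes. -/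
def Expr.cost : Expr → ℕ
  | .const _ => 1
  | .var _ => 1
  | .read _ i => i.cost + 1
  | .add e₁ e₂ => e₁.cost + e₂.cost + 1
  | .sub e₁ e₂ => e₁.cost + e₂.cost + 1
  | .lt e₁ e₂ => e₁.cost + e₂.cost + 1
  | .eq e₁ e₂ => e₁.cost + e₂.cost + 1

/-- Programs: assignments to registers and to array cells, oracle calls, sequencing, branching,
and while loops. Conditions count as true when they are nonzero. -/
inductive Prog where
  | skip
  | assign (x : ℕ) (e : Expr)
  | write (a : ℕ) (i e : Expr)
  | query (x a : ℕ) (len : Expr)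
  | seq (p q : Prog)
  | ite (e : Expr) (p q : Prog)
  | loop (e : Expr) (p : Prog)

/-- The program makes no oracle calls. -/
def Prog.OracleFree : Prog → Prop
  | .skip => True
  | .assign _ _ => True
  | .write _ _ _ => True
  | .query _ _ _ => False
  | .seq p q => p.OracleFree ∧ q.OracleFree
  | .ite _ p q => p.OracleFree ∧ q.OracleFree
  | .loop _ p => p.OracleFree

/-- The memory after writing `v` into register `x`. -/
def Memory.setVar (s : Memory) (x v : ℕ) : Memory :=
  { s with var := Function.update s.var x v }

/-- The memory after writing `v` into cell `i` of array `a`. -/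
def Memory.setArr (s : Memory) (a i v : ℕ) : Memory :=
  { s with arr := Function.update s.arr a (Function.update (s.arr a) i v) }

/-- The set whose characteristic vector is stored in the first `len` cells of array `a`. -/
def Memory.storedSet (s : Memory) (a len : ℕ) : Set ℕ :=
  {i | i < len ∧ s.arr a i ≠ 0}

open Classical in
/-- `Exec O p s t s'`: with the oracle `O`, the program `p` started with memory `s` halts after
exactly `t` steps with memory `s'`. The call `query x a len` stores in register `x` whether
the set given by the first `len` cells of array `a` satisfies `O` (`1` for yes, `0` for no);
reading the set is charged with `len` steps. -/
inductive Exec (O : Set ℕ → Prop) : Prog → Memory → ℕ → Memory → Prop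
  | skip (s : Memory) : Exec O .skip s 1 s
  | assign (s : Memory) (x : ℕ) (e : Expr) :
      Exec O (.assign x e) s (e.cost + 1) (s.setVar x (e.eval s))
  | write (s : Memory) (a : ℕ) (i e : Expr) :
      Exec O (.write a i e) s (i.cost + e.cost + 1) (s.setArr a (i.eval s) (e.eval s))
  | query (s : Memory) (x a : ℕ) (len : Expr) :
      Exec O (.query x a len) s (len.cost + len.eval s + 1)
        (s.setVar x (if O (s.storedSet a (len.eval s)) then 1 else 0))
  | seq {p q : Prog} {s₁ s₂ s₃ : Memory} {t₁ t₂ : ℕ} :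
      Exec O p s₁ t₁ s₂ → Exec O q s₂ t₂ s₃ → Exec O (.seq p q) s₁ (t₁ + t₂) s₃
  | ite_true {e : Expr} {p : Prog} (q : Prog) {s s' : Memory} {t : ℕ} :
      e.eval s ≠ 0 → Exec O p s t s' → Exec O (.ite e p q) s (e.cost + t + 1) s'
  | ite_false {e : Expr} (p : Prog) {q : Prog} {s s' : Memory} {t : ℕ} :
      e.eval s = 0 → Exec O q s t s' → Exec O (.ite e p q) s (e.cost + t + 1) s'
  | loop_true {e : Expr} {p : Prog} {s₁ s₂ s₃ : Memory} {t₁ t₂ : ℕ} :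
      e.eval s₁ ≠ 0 → Exec O p s₁ t₁ s₂ → Exec O (.loop e p) s₂ t₂ s₃ →
        Exec O (.loop e p) s₁ (e.cost + t₁ + t₂ + 1) s₃
  | loop_false {e : Expr} (p : Prog) {s : Memory} :
      e.eval s = 0 → Exec O (.loop e p) s (e.cost + 1) s

/-! ## Matroids -/

section Matroids

variable {α C : Type*}

/-- A coloring of the ground set is `ℓ`-courteous if the deletion of the elements of any at most
`ℓ` colors does not change the rank of the matroid. -/
def IsCourteous (M : Matroid α) (ℓ : ℕ) (f : M.E → C) : Prop :=
  ∀ D : Finset C, D.card ≤ ℓ →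
    (M.delete (Subtype.val '' (f ⁻¹' (D : Set C)))).eRank = M.eRank

/-- A matroid is bridgeless if it has no cut (that is, circuit of the dual) of size one. -/
def Bridgeless (M : Matroid α) : Prop :=
  ∀ e : α, ¬ M✶.IsCircuit {e}

/-- An `ℓ`-courteous coloring that uses the minimum number of colors. -/
def IsMinCourteous (M : Matroid α) (ℓ : ℕ) (f : M.E → ℕ) : Prop :=
  IsCourteous M ℓ f ∧
    ∀ g : M.E → ℕ, IsCourteous M ℓ g → (Set.range f).ncard ≤ (Set.range g).ncard

/-- The independence oracle of a matroid whose ground set is numbered by `lab`. -/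
def indepOracle (M : Matroid α) {n : ℕ} (lab : Fin n ≃ M.E) (X : Set ℕ) : Prop :=
  M.Indep {x | ∃ i : Fin n, (i : ℕ) ∈ X ∧ (lab i : α) = x}

/-- The initial memory for a matroid on `n` elements: register `0` contains `n`, and everything
else is `0`. -/
def matroidInput (n : ℕ) : Memory where
  var x := if x = 0 then n else 0
  arr _ _ := 0

end Matroids

/-! ## Graphs (finite, with loops and parallel edges allowed) -/

section Graphs

variable {α β C : Type*}

/-- `IsWalk G u p v`: following the list `p` of edges, each paired with the vertex it leads to,
is a walk from `u` to `v` in `G`. -/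
inductive IsWalk (G : Graph α β) : α → List (β × α) → α → Prop
  | nil {u : α} : u ∈ G.vertexSet → IsWalk G u [] u
  | cons {u w v : α} {e : β} {p : List (β × α)} :
      G.IsLink e u w → IsWalk G w p v → IsWalk G u ((e, w) :: p) v

/-- A path is a walk without repeated vertices. -/
def IsPath (G : Graph α β) (u : α) (p : List (β × α)) (v : α) : Prop :=
  IsWalk G u p v ∧ (u :: p.map Prod.snd).Nodup

/-- A graph is `k`-edge-connected if it has at least two vertices and there are `k` pairwise
edge-disjoint paths between any two vertices, or if it has one vertex and at least `k` loops. -/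
def EdgeConnected (G : Graph α β) (k : ℕ) : Prop :=
  (G.vertexSet.Nontrivial ∧
    ∀ u ∈ G.vertexSet, ∀ v ∈ G.vertexSet, u ≠ v →
      ∃ P : Fin k → List (β × α), (∀ i, IsPath G u (P i) v) ∧
        ∀ i j, i ≠ j → ((P i).map Prod.fst).Disjoint ((P j).map Prod.fst)) ∨
  (G.vertexSet.encard = 1 ∧ (k : ℕ∞) ≤ G.edgeSet.encard)

/-- A graph is connected if it has a vertex and there is a path between any two vertices
(a single vertex is connected, with or without loops). -/
def Connected (G : Graph α β) : Prop :=
  G.vertexSet.Nonempty ∧ ∀ u ∈ G.vertexSet, ∀ v ∈ G.vertexSet, ∃ p, IsPath G u p v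

/-- An edge-coloring is edge-`ℓ`-color-avoiding connected if after the removal of the edges of
any at most `ℓ` colors the remaining graph is connected. -/
def IsColorAvoiding (G : Graph α β) (ℓ : ℕ) (f : G.edgeSet → C) : Prop :=
  ∀ D : Finset C, D.card ≤ ℓ →
    Connected (G.deleteEdges (Subtype.val '' (f ⁻¹' (D : Set C))))

/-- An edge-`ℓ`-color-avoiding connected coloring that uses the minimum number of colors. -/
def IsMinColorAvoiding (G : Graph α β) (ℓ : ℕ) (f : G.edgeSet → ℕ) : Prop :=
  IsColorAvoiding G ℓ f ∧
    ∀ g : G.edgeSet → ℕ, IsColorAvoiding G ℓ g → (Set.range f).ncard ≤ (Set.range g).ncard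

/-- The initial memory for a graph with `n` vertices and `m` edges: registers `0` and `1` contain
`n` and `m`, cell `i` of arrays `0` and `1` contains the two ends of the `i`-th edge, and
everything else is `0`. -/
def graphInput (n m : ℕ) (end₀ end₁ : Fin m → Fin n) : Memory where
  var x := if x = 0 then n else if x = 1 then m else 0
  arr a i :=
    if h : i < m then
      if a = 0 then (end₀ ⟨i, h⟩ : ℕ) else if a = 1 then (end₁ ⟨i, h⟩ : ℕ) else 0
    else 0

end Graphs

end Courteous

/-! Deleting a set `X` keeps the rank of `M` exactly when the complement of `X` is spanning, that
is, when `X` is independent in the dual (`isCourteous_one_iff`). A 1-courteous coloring is therefore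
a partition of the ground set into independent sets of `M✶`; bridgelessness says that `M✶` has no
loops, so such partitions exist. What remains is matroid partition with an independence test for `N
= M✶`.

Elements are inserted one at a time into a partial coloring with `k` independent classes. A sink is
an element that can be added to another class; an arc `y → z` means that `y` can replace `z` in the
class of `z`. If a sink can be reached from the uncolored element `x`, a nearest one is recolored.
No whole augmenting path is exchanged at once: arcs between elements that are not sinks survive
(`IsArc.update`), and the predecessor of the recolored element becomes a sink
(`IsArc.isSink_update`), so the distance drops (`exists_isSink_update`) and after at most `n` rounds
`x` itself is colored, unless sinks become unreachable. If no sink is reachable, let `R` be the set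
reachable from `x`. Every class meets `R` in a basis of `R`, and `x` lies in no class, so `R` has
more than `k · r(R)` elements. Hence every partition needs `k + 1` classes (`needsColors_succ`), and
`x` may receive a new color.

The independence test for `M✶` finds a basis of `E \ X` greedily with the oracle and checks that no
element of `X` extends it (`coindepTest_run`). For a graph, `N` is the dual of the cycle matroid,
represented by differences of unit vectors over `ℚ`; in a connected graph a set of edges is
independent in `N` iff the graph stays connected without it (`cycleMatroid_dual_indep_iff`). This is
tested without oracle by flooding (`connectedTest_run`), and 2-edge-connectedness excludes loops of
`N`.

The programs are written in a language in which every loop is bounded by an input size stored in a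
register that never changes. Termination and a polynomial step bound then follow from the syntax
alone (`exec_compile`), and correctness is proved with loop invariants (`run_forTo`). -/

namespace Courteous

/-! ## Programs with bounded loops -/

/-- Programs whose loops run through the numbers below the content of a register. -/
inductive ForProg where
  | skip
  | assign (x : ℕ) (e : Expr)
  | write (a : ℕ) (i e : Expr)
  | query (x a r : ℕ)
  | seq (p q : ForProg)
  | ite (e : Expr) (p q : ForProg)
  | forTo (i r : ℕ) (p : ForProg)

namespace ForProg

/-- The underlying program. -/
def compile : ForProg → Prog
  | .skip => .skip
  | .assign x e => .assign x e
  | .write a i e => .write a i e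
  | .query x a r => .query x a (.var r)
  | .seq p q => .seq p.compile q.compile
  | .ite e p q => .ite e p.compile q.compile
  | .forTo i r p => .seq (.assign i (.const 0)) (.loop (.lt (.var i) (.var r))
      (.seq p.compile (.assign i (.add (.var i) (.const 1)))))

/-- The registers a program may modify. -/
def regs : ForProg → List ℕ
  | .skip => []
  | .assign x _ => [x]
  | .write _ _ _ => []
  | .query x _ _ => [x]
  | .seq p q => p.regs ++ q.regs
  | .ite _ p q => p.regs ++ q.regs
  | .forTo i _ p => i :: p.regs

/-- The arrays a program may modify. -/
def arrs : ForProg → List ℕ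
  | .skip => []
  | .assign _ _ => []
  | .write a _ _ => [a]
  | .query _ _ _ => []
  | .seq p q => p.arrs ++ q.arrs
  | .ite _ p q => p.arrs ++ q.arrs
  | .forTo _ _ p => p.arrs

/-- Registers `0` and `1` are never modified, they are the only loop bounds and lengths of queries,
and the bodies of loops do not modify the loop variable. -/
def WellFormed : ForProg → Prop
  | .skip => True
  | .assign x _ => 2 ≤ x
  | .write _ _ _ => True
  | .query x _ r => 2 ≤ x ∧ r < 2
  | .seq p q => p.WellFormed ∧ q.WellFormed
  | .ite _ p q => p.WellFormed ∧ q.WellFormed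
  | .forTo i r p => 2 ≤ i ∧ r < 2 ∧ i ∉ p.regs ∧ p.WellFormed

open Classical in
/-- The effect of a program on the memory. -/
noncomputable def run (O : Set ℕ → Prop) : ForProg → Memory → Memory
  | .skip, s => s
  | .assign x e, s => s.setVar x (e.eval s)
  | .write a i e, s => s.setArr a (i.eval s) (e.eval s)
  | .query x a r, s => s.setVar x (if O (s.storedSet a (s.var r)) then 1 else 0)
  | .seq p q, s => q.run O (p.run O s)
  | .ite e p q, s => if e.eval s ≠ 0 then p.run O s else q.run O s
  | .forTo i r p, s =>
      Nat.rec (s.setVar i 0) (fun k s' => (p.run O s').setVar i (k + 1)) (s.var r)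

/-- A bound for the number of steps, where the variable is a bound for registers `0` and `1`. -/
noncomputable def cost : ForProg → Polynomial ℕ
  | .skip => 1
  | .assign _ e => Polynomial.C (e.cost + 1)
  | .write _ i e => Polynomial.C (i.cost + e.cost + 1)
  | .query _ _ _ => Polynomial.X + 2
  | .seq p q => p.cost + q.cost
  | .ite e p q => p.cost + q.cost + Polynomial.C (e.cost + 1)
  | .forTo _ _ p => Polynomial.X * (p.cost + 8) + 6

end ForProg

@[simp] theorem Memory.setVar_var (s : Memory) (x v y : ℕ) :
    (s.setVar x v).var y = if y = x then v else s.var y := by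
  simp [Memory.setVar, Function.update_apply]

@[simp] theorem Memory.setVar_arr (s : Memory) (x v : ℕ) : (s.setVar x v).arr = s.arr := rfl

@[simp] theorem Memory.setArr_var (s : Memory) (a i v : ℕ) : (s.setArr a i v).var = s.var := rfl

theorem Memory.setArr_arr (s : Memory) (a i v b : ℕ) :
    (s.setArr a i v).arr b = if b = a then Function.update (s.arr a) i v else s.arr b := by
  simp [Memory.setArr, Function.update_apply]

@[simp] theorem Memory.setArr_arr_of_ne (s : Memory) (a i v : ℕ) {b : ℕ} (h : b ≠ a) :
    (s.setArr a i v).arr b = s.arr b := by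
  rw [Memory.setArr_arr, if_neg h]

@[simp] theorem Memory.setArr_arr_self (s : Memory) (a i v j : ℕ) :
    (s.setArr a i v).arr a j = if j = i then v else s.arr a j := by
  simp [Memory.setArr_arr, Function.update_apply]

/-- Outside the given registers and arrays the two memories agree. -/
def AgreeOff (X A : List ℕ) (s s' : Memory) : Prop :=
  (∀ x ∉ X, s'.var x = s.var x) ∧ ∀ a ∉ A, s'.arr a = s.arr a

theorem AgreeOff.refl (X A : List ℕ) (s : Memory) : AgreeOff X A s s :=
  ⟨fun _ _ => rfl, fun _ _ => rfl⟩

theorem AgreeOff.trans {X A : List ℕ} {s s' s'' : Memory} (h : AgreeOff X A s s')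
    (h' : AgreeOff X A s' s'') : AgreeOff X A s s'' :=
  ⟨fun x hx => (h'.1 x hx).trans (h.1 x hx), fun x hx => (h'.2 x hx).trans (h.2 x hx)⟩

theorem AgreeOff.mono {X A X' A' : List ℕ} {s s' : Memory} (h : AgreeOff X A s s')
    (hX : X ⊆ X') (hA : A ⊆ A') : AgreeOff X' A' s s' :=
  ⟨fun x hx => h.1 x fun hx' => hx (hX hx'), fun x hx => h.2 x fun hx' => hx (hA hx')⟩

theorem AgreeOff.setVar {X A : List ℕ} {s s' : Memory} (h : AgreeOff X A s s') {x : ℕ}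
    (hx : x ∈ X) (v : ℕ) : AgreeOff X A s (s'.setVar x v) := by
  refine ⟨fun y hy => ?_, fun a ha => h.2 a ha⟩
  rw [Memory.setVar_var, if_neg (by rintro rfl; exact hy hx), h.1 y hy]

namespace ForProg

variable {O : Set ℕ → Prop}

theorem run_agreeOff (p : ForProg) (s : Memory) : AgreeOff p.regs p.arrs s (p.run O s) := by
  induction p generalizing s with
  | skip => exact .refl _ _ _
  | assign x e => exact (AgreeOff.refl _ _ _).setVar (by simp [regs]) _
  | write a i e =>
    refine ⟨fun _ _ => rfl, fun b hb => ?_⟩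
    simp only [arrs, List.mem_singleton] at hb
    simp [run, hb]
  | query x a r => exact (AgreeOff.refl _ _ _).setVar (by simp [regs]) _
  | seq p q hp hq =>
    exact ((hp s).mono (by simp [regs]) (by simp [arrs])).trans
      ((hq _).mono (by simp [regs]) (by simp [arrs]))
  | ite e p q hp hq =>
    rw [run]
    split_ifs
    · exact (hp s).mono (by simp [regs]) (by simp [arrs])
    · exact (hq s).mono (by simp [regs]) (by simp [arrs])
  | forTo i r p hp =>
    rw [run]
    induction s.var r with
    | zero => exact (AgreeOff.refl _ _ _).setVar (by simp [regs]) _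
    | succ k ih =>
      exact (ih.trans ((hp _).mono (by simp [regs]) (by simp [arrs]))).setVar (by simp [regs]) _

theorem run_var_of_notMem {p : ForProg} {x : ℕ} (h : x ∉ p.regs) (s : Memory) :
    (p.run O s).var x = s.var x :=
  (p.run_agreeOff s).1 x h

theorem run_arr_of_notMem {p : ForProg} {a : ℕ} (h : a ∉ p.arrs) (s : Memory) :
    (p.run O s).arr a = s.arr a :=
  (p.run_agreeOff s).2 a h

theorem WellFormed.two_le {p : ForProg} (hp : p.WellFormed) {x : ℕ} (hx : x ∈ p.regs) :
    2 ≤ x := by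
  induction p with
  | skip => simp [regs] at hx
  | assign y e => simp_all [regs, WellFormed]
  | write a i e => simp [regs] at hx
  | query y a r => simp_all [regs, WellFormed]
  | seq p q ihp ihq =>
    rcases List.mem_append.1 hx with h | h
    exacts [ihp hp.1 h, ihq hp.2 h]
  | ite e p q ihp ihq =>
    rcases List.mem_append.1 hx with h | h
    exacts [ihp hp.1 h, ihq hp.2 h]
  | forTo i r p ihp =>
    rcases List.mem_cons.1 hx with rfl | h
    exacts [hp.1, ihp hp.2.2.2 h]

theorem WellFormed.run_var {p : ForProg} (hp : p.WellFormed) {x : ℕ} (hx : x < 2) (s : Memory) :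
    (p.run O s).var x = s.var x :=
  run_var_of_notMem (fun h => absurd (hp.two_le h) (by omega)) s

/-- The rule for loops. -/
theorem run_forTo {i r : ℕ} {p : ForProg} {s : Memory} (I : ℕ → Memory → Prop)
    (zero : I 0 (s.setVar i 0))
    (succ : ∀ k < s.var r, ∀ s', s'.var i = k → AgreeOff (i :: p.regs) p.arrs s s' → I k s' →
      I (k + 1) ((p.run O s').setVar i (k + 1))) :
    I (s.var r) ((forTo i r p).run O s) := by
  have key : ∀ n ≤ s.var r, ∀ F : Memory,
      F = Nat.rec (s.setVar i 0) (fun k s' => (p.run O s').setVar i (k + 1)) n →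
      F.var i = n ∧ AgreeOff (i :: p.regs) p.arrs s F ∧ I n F := by
    intro n
    induction n with
    | zero =>
      rintro - F rfl
      exact ⟨by simp, (AgreeOff.refl _ _ _).setVar (by simp) _, zero⟩
    | succ n ih =>
      rintro hn F rfl
      obtain ⟨h₁, h₂, h₃⟩ := ih (by omega) _ rfl
      refine ⟨by simp, ?_, succ n (by omega) _ h₁ h₂ h₃⟩
      exact (h₂.trans ((p.run_agreeOff _).mono (by simp) (by simp))).setVar (by simp) _
  exact (key _ le_rfl _ rfl).2.2

/-- Loop bounds and query lengths are read from registers `0` and `1`, which a well-formed program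
never changes. Each loop thus makes at most `n` rounds, and the bound is a polynomial built along
the syntax. -/
theorem exec_compile {p : ForProg} (hp : p.WellFormed) {n : ℕ} (s : Memory)
    (h₀ : s.var 0 ≤ n) (h₁ : s.var 1 ≤ n) :
    ∃ t ≤ p.cost.eval n, Exec O p.compile s t (p.run O s) := by
  induction p generalizing s with
  | skip => exact ⟨1, by simp [cost], .skip s⟩
  | assign x e => exact ⟨_, by simp [cost], .assign s x e⟩
  | write a i e => exact ⟨_, by simp [cost], .write s a i e⟩
  | query x a r =>
    refine ⟨_, ?_, .query s x a (.var r)⟩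
    have hr : s.var r ≤ n := by
      obtain ⟨-, h⟩ := hp
      interval_cases r <;> assumption
    simp only [cost, Expr.cost, Expr.eval, Polynomial.eval_add, Polynomial.eval_X,
      Polynomial.eval_ofNat]
    omega
  | seq p q ihp ihq =>
    obtain ⟨t, ht, hpt⟩ := ihp hp.1 s h₀ h₁
    obtain ⟨t', ht', hqt⟩ := ihq hp.2 (p.run O s) (by rwa [hp.1.run_var (by omega)])
      (by rwa [hp.1.run_var (by omega)])
    exact ⟨t + t', by simp only [cost, Polynomial.eval_add]; omega, hpt.seq hqt⟩
  | ite e p q ihp ihq =>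
    rw [run]
    split_ifs with h
    · obtain ⟨t, ht, hpt⟩ := ihp hp.1 s h₀ h₁
      refine ⟨_, ?_, .ite_true _ h hpt⟩
      simp only [cost, Polynomial.eval_add, Polynomial.eval_C]; omega
    · obtain ⟨t, ht, hqt⟩ := ihq hp.2 s h₀ h₁
      refine ⟨_, ?_, .ite_false _ (not_not.1 h) hqt⟩
      simp only [cost, Polynomial.eval_add, Polynomial.eval_C]; omega
  | forTo i r p ih =>
    obtain ⟨hi, hr, hip, hp⟩ := hp
    set F : ℕ → Memory :=
      fun k => Nat.rec (s.setVar i 0) (fun k s' => (p.run O s').setVar i (k + 1)) k with hF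
    have hFi : ∀ k, (F k).var i = k := by
      rintro (_ | k) <;> simp [hF]
    have hF2 : ∀ x < 2, ∀ k, (F k).var x = s.var x := by
      intro x hx k
      induction k with
      | zero => simp [hF, show x ≠ i by omega]
      | succ k ihk =>
        have : (F (k + 1)).var x = (p.run O (F k)).var x := by simp [hF, show x ≠ i by omega]
        rw [this, hp.run_var hx, ihk]
    have hrn : s.var r ≤ n := by interval_cases r <;> assumption
    -- Induction on the number `d` of remaining rounds. A round costs `3` for the test, `1` for the
    -- loop and `4` for the increment besides the body; the final failing test costs `4`. The
    -- initialization adds `2` more, whence the `6` in `cost`.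
    have key : ∀ d k, k + d = s.var r → ∃ t ≤ d * (p.cost.eval n + 8) + 4,
        Exec O (.loop (.lt (.var i) (.var r)) (.seq p.compile
          (.assign i (.add (.var i) (.const 1))))) (F k) t (F (s.var r)) := by
      intro d
      induction d with
      | zero =>
        rintro k hk
        obtain rfl : k = s.var r := by omega
        exact ⟨_, by simp [Expr.cost], .loop_false _ (by simp [Expr.eval, hFi, hF2 r hr])⟩
      | succ d ihd =>
        intro k hk
        obtain ⟨t, ht, hpt⟩ := ih hp (F k) (by rwa [hF2 0 (by omega)]) (by rwa [hF2 1 (by omega)])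
        obtain ⟨t', ht', hlt⟩ := ihd (k + 1) (by omega)
        have hstep : Exec O (.assign i (.add (.var i) (.const 1))) (p.run O (F k)) 4
            (F (k + 1)) := by
          have := Exec.assign (O := O) (p.run O (F k)) i (.add (.var i) (.const 1))
          simpa [Expr.cost, Expr.eval, run_var_of_notMem hip, hFi] using this
        refine ⟨_, ?_, .loop_true ?_ (hpt.seq hstep) hlt⟩
        · simp only [Expr.cost]
          nlinarith
        · simp [Expr.eval, hFi, hF2 r hr]
          omega
    obtain ⟨t, ht, hlt⟩ := key (s.var r) 0 (by omega)
    refine ⟨_, ?_, (Exec.assign s i (.const 0)).seq hlt⟩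
    simp only [Expr.cost, cost, Polynomial.eval_add, Polynomial.eval_mul, Polynomial.eval_X,
      Polynomial.eval_ofNat]
    nlinarith [Nat.mul_le_mul_right (p.cost.eval n + 8) hrn]

/-- Fill the cells of array `a` whose index is below the content of register `r` with the values
of an expression in register `j`. -/
def fill (a j r : ℕ) (e : Expr) : ForProg :=
  .forTo j r (.write a (.var j) e)

theorem fill_agreeOff (a j r : ℕ) (e : Expr) (s : Memory) :
    AgreeOff [j] [a] s ((fill a j r e).run O s) :=
  run_agreeOff (fill a j r e) s

/-- The expression is evaluated while the array is only partly filled, so its value must be known in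
every memory that differs from `s` in register `j` and array `a` only. -/
theorem run_fill {a j r : ℕ} {e : Expr} {s : Memory} (f : ℕ → ℕ)
    (hf : ∀ s', AgreeOff [j] [a] s s' → s'.var j < s.var r → e.eval s' = f (s'.var j)) {i : ℕ}
    (hi : i < s.var r) : ((fill a j r e).run O s).arr a i = f i := by
  refine run_forTo (r := r) (fun k s' => ∀ i < k, s'.arr a i = f i) (by simp) ?_ i hi
  intro k hk s' hj hs' ih i hi
  rw [Memory.setVar_arr, run, Memory.setArr_arr_self]
  simp only [Expr.eval, hj]
  rcases Nat.lt_succ_iff_lt_or_eq.1 hi with hi | rfl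
  · rw [if_neg hi.ne, ih i hi]
  · rw [if_pos rfl, hf s' (by simpa [regs, arrs] using hs') (hj ▸ hk), hj]

end ForProg

/-! ### Boolean connectives in expressions -/

namespace Expr

/-- Negation. -/
def not (e : Expr) : Expr := .eq e (.const 0)

/-- Conjunction. -/
def and (e₁ e₂ : Expr) : Expr := .not (.add e₁.not e₂.not)

@[simp] theorem eval_not {s : Memory} {e : Expr} : e.not.eval s ≠ 0 ↔ e.eval s = 0 := by
  simp only [not, eval]
  split_ifs <;> simp_all

@[simp] theorem eval_not_eq_zero {s : Memory} {e : Expr} : e.not.eval s = 0 ↔ e.eval s ≠ 0 := by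
  simp only [not, eval]
  split_ifs <;> simp_all

theorem eval_lt {s : Memory} {e₁ e₂ : Expr} :
    (Expr.lt e₁ e₂).eval s ≠ 0 ↔ e₁.eval s < e₂.eval s := by
  simp [eval]

theorem eval_eq_eq_zero {s : Memory} {e₁ e₂ : Expr} :
    (Expr.eq e₁ e₂).eval s = 0 ↔ e₁.eval s ≠ e₂.eval s := by
  simp [eval]

@[simp] theorem eval_and {s : Memory} {e₁ e₂ : Expr} :
    (e₁.and e₂).eval s ≠ 0 ↔ e₁.eval s ≠ 0 ∧ e₂.eval s ≠ 0 := by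
  rw [and, eval_not]
  simp [eval]

end Expr

end Courteous

namespace Courteous

/-! ## Partitioning a matroid into independent sets -/

section Partition

variable {α : Type*} {N : Matroid α} {col : α → ℕ} {k : ℕ}

/-- The elements of a given color. -/
def colorClass (N : Matroid α) (col : α → ℕ) (c : ℕ) : Set α := {j ∈ N.E | col j = c}

/-- The element `y` can be recolored with `c`. Color `0` stands for uncolored elements. -/
def IsSink (N : Matroid α) (col : α → ℕ) (k : ℕ) (y : α) (c : ℕ) : Prop :=
  1 ≤ c ∧ c ≤ k ∧ col y ≠ c ∧ N.Indep (insert y (colorClass N col c))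

/-- The element `y` can replace the element `z` in the color class of `z`. -/
def IsArc (N : Matroid α) (col : α → ℕ) (y z : α) : Prop :=
  z ∈ N.E ∧ col z ≠ 0 ∧ col z ≠ col y ∧ N.Indep (insert y (colorClass N col (col z)) \ {z})

/-- The elements at distance at most `t` from `x`. -/
def arcBall (N : Matroid α) (col : α → ℕ) (x : α) : ℕ → Set α
  | 0 => {x}
  | t + 1 => {z | z ∈ arcBall N col x t ∨ ∃ y ∈ arcBall N col x t, IsArc N col y z}

/-- A partial coloring with colors `1, …, k` and independent color classes. -/
def IsPartialColoring (N : Matroid α) (col : α → ℕ) (k : ℕ) : Prop :=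
  (∀ j, col j ≤ k) ∧ ∀ c, 1 ≤ c → N.Indep (colorClass N col c)

/-- Every coloring with independent color classes uses at least `k` colors. -/
def NeedsColors (N : Matroid α) (k : ℕ) : Prop :=
  ∀ g : α → ℕ, (∀ c, N.Indep (colorClass N g c)) → k ≤ (g '' N.E).ncard

theorem arcBall_subset_ground {x : α} (hx : x ∈ N.E) (t : ℕ) : arcBall N col x t ⊆ N.E := by
  induction t with
  | zero => simpa [arcBall] using hx
  | succ t ih => exact fun z hz => hz.elim (fun h => ih h) fun ⟨_, _, h⟩ => h.1

theorem arcBall_mono {x : α} {t t' : ℕ} (h : t ≤ t') : arcBall N col x t ⊆ arcBall N col x t' :=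
  monotone_nat_of_le_succ (f := arcBall N col x) (fun _ _ hz => Or.inl hz) h

theorem mem_arcBall_self (x : α) (t : ℕ) : x ∈ arcBall N col x t :=
  arcBall_mono (Nat.zero_le t) rfl

/-- Arcs end in colored elements. Recoloring a sink reached from `x` hence never gives a color to an
uncolored element other than `x`. -/
theorem eq_or_col_ne_zero_of_mem_arcBall {x z : α} {t : ℕ} (hz : z ∈ arcBall N col x t) :
    z = x ∨ col z ≠ 0 := by
  induction t with
  | zero => exact Or.inl hz
  | succ t ih => exact hz.elim ih fun ⟨_, _, h⟩ => Or.inr h.2.1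

/-! ### Recoloring a single sink -/

section Recolor

variable [DecidableEq α] {y : α} {c : ℕ}

theorem colorClass_update_self (hy : y ∈ N.E) :
    colorClass N (Function.update col y c) c = insert y (colorClass N col c) := by
  ext j
  simp only [colorClass, Function.update_apply, Set.mem_ofPred_eq, Set.mem_insert_iff]
  split_ifs with h <;> simp [h, hy]

theorem colorClass_update_of_ne {d : ℕ} (hd : d ≠ c) :
    colorClass N (Function.update col y c) d = colorClass N col d \ {y} := by
  ext j
  simp only [colorClass, Function.update_apply, Set.mem_ofPred_eq, Set.mem_sdiff,
    Set.mem_singleton_iff]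
  split_ifs with h <;> simp [h, hd.symm]

theorem IsSink.isPartialColoring_update (hy : y ∈ N.E) (h : IsSink N col k y c)
    (hcol : IsPartialColoring N col k) :
    IsPartialColoring N (Function.update col y c) k := by
  refine ⟨fun j => ?_, fun d hd => ?_⟩
  · rw [Function.update_apply]
    split_ifs
    exacts [h.2.1, hcol.1 j]
  · by_cases hdc : d = c
    · rw [hdc, colorClass_update_self hy]
      exact h.2.2.2
    · rw [colorClass_update_of_ne hdc]
      exact (hcol.2 d hd).subset Set.sdiff_subset

/-- Arcs between elements that cannot be recolored survive the recoloring of another element. -/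
theorem IsArc.update (hy : y ∈ N.E) (hyc : IsSink N col k y c) (hcol : IsPartialColoring N col k)
    {u v : α} (hu : ∀ d, ¬ IsSink N col k u d) (hv : ∀ d, ¬ IsSink N col k v d) (huE : u ∈ N.E)
    (h : IsArc N col u v) : IsArc N (Function.update col y c) u v := by
  have huy : u ≠ y := by rintro rfl; exact hu c hyc
  have hvy : v ≠ y := by rintro rfl; exact hv c hyc
  obtain ⟨hvE, hv0, hvu, hI⟩ := h
  refine ⟨hvE, ?_⟩
  rw [Function.update_of_ne hvy, Function.update_of_ne huy]
  refine ⟨hv0, hvu, ?_⟩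
  -- If `v` lies in the class that gains `y`, independence after the exchange has to be reproved;
  -- the other classes can only shrink.
  by_cases hc : col v = c
  · rw [hc] at hI ⊢
    rw [colorClass_update_self hy]
    have hcls := hcol.2 c hyc.1
    have hdep : ¬ N.Indep (insert u (colorClass N col c)) :=
      fun hi => hu c ⟨hyc.1, hyc.2.1, fun h => hvu (hc.trans h.symm), hi⟩
    have hucls : u ∉ colorClass N col c := fun h => hvu (hc.trans h.2.symm)
    have hucl : u ∈ N.closure (colorClass N col c) := by
      rw [hcls.mem_closure_iff_of_notMem hucls]
      exact ⟨hdep, Set.insert_subset huE hcls.subset_ground⟩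
    have hucl' := N.closure_subset_closure (Set.subset_insert y (colorClass N col c)) hucl
    have hucls' : u ∉ insert y (colorClass N col c) := by simp [huy, hucls]
    rw [← hcls.mem_fundCircuit_iff hucl hucls] at hI
    -- Since `u` is not a sink, it closes a circuit with the old class. The class together with `y`
    -- is still independent, so this is also the fundamental circuit of `u` in the enlarged class,
    -- and it still contains `v`.
    rw [← hyc.2.2.2.mem_fundCircuit_iff hucl' hucls',
      ← (hcls.fundCircuit_isCircuit hucl hucls).eq_fundCircuit_of_subset hyc.2.2.2]
    · exact hI
    · exact (N.fundCircuit_subset_insert u _).trans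
        (Set.insert_subset_insert (Set.subset_insert _ _))
  · rw [colorClass_update_of_ne hc]
    exact hI.subset (Set.sdiff_subset_sdiff_left (Set.insert_subset_insert Set.sdiff_subset))

/-- Once `y` has left its class, the exchange of `u` for `y` becomes the mere addition of `u`. -/
theorem IsArc.isSink_update (hcol : IsPartialColoring N col k) {u : α} (huy : u ≠ y)
    (hyc : IsSink N col k y c) (h : IsArc N col u y) :
    IsSink N (Function.update col y c) k u (col y) := by
  obtain ⟨-, hy0, hyu, hI⟩ := h
  refine ⟨Nat.one_le_iff_ne_zero.2 hy0, hcol.1 y, ?_, ?_⟩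
  · rw [Function.update_of_ne huy]
    exact hyu.symm
  · rw [colorClass_update_of_ne hyc.2.2.1]
    rwa [Set.insert_sdiff_of_notMem _ (by simpa using huy)] at hI

/-- Recoloring a nearest sink brings the sinks nearer. -/
theorem exists_isSink_update {x : α} (hx : x ∈ N.E) (hcol : IsPartialColoring N col k) {t : ℕ}
    (hy : y ∈ arcBall N col x (t + 1)) (hyc : IsSink N col k y c)
    (hno : ∀ z ∈ arcBall N col x t, ∀ d, ¬ IsSink N col k z d) :
    ∃ z ∈ arcBall N (Function.update col y c) x t,
      ∃ d, IsSink N (Function.update col y c) k z d := by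
  have hyE : y ∈ N.E := arcBall_subset_ground hx _ hy
  -- No element of the ball of radius `t` is a sink, so all arcs inside it survive and the balls up
  -- to this radius do not lose elements.
  have hball : ∀ i ≤ t, arcBall N col x i ⊆ arcBall N (Function.update col y c) x i := by
    intro i
    induction i with
    | zero => exact fun _ => subset_rfl
    | succ i ih =>
      intro hi z hz
      have hz' := hno z (arcBall_mono hi hz)
      rcases hz with hz | ⟨u, hu, huz⟩
      · exact Or.inl (ih (by omega) hz)
      · refine Or.inr ⟨u, ih (by omega) hu, huz.update hyE hyc hcol ?_ hz' ?_⟩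
        · exact hno u (arcBall_mono (by omega) hu)
        · exact arcBall_subset_ground hx _ hu
  rcases hy with hy | ⟨u, hu, huy⟩
  · exact absurd hyc (hno y hy c)
  -- The predecessor `u` of `y` can now take the old color of `y`.
  · refine ⟨u, hball t le_rfl hu, col y, huy.isSink_update hcol ?_ hyc⟩
    rintro rfl
    exact hno _ hu c hyc

end Recolor

/-- If no sink can be reached from an uncolored element, an additional color is needed. -/
theorem needsColors_succ [N.Finite] {x : α} (hx : x ∈ N.E) (hx0 : col x = 0)
    (hcol : IsPartialColoring N col k)
    (hno : ∀ t < N.E.ncard, ∀ y ∈ arcBall N col x t, ∀ c, ¬ IsSink N col k y c) :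
    NeedsColors N (k + 1) := by
  classical
  have hfin := N.ground_finite
  -- A ball of radius `t` that has grown in every step has at least `t + 1` elements, so the growth
  -- stops before radius `|E|`.
  obtain ⟨t, ht, hstab⟩ : ∃ t < N.E.ncard, arcBall N col x (t + 1) = arcBall N col x t := by
    by_contra! hne
    have hcard : ∀ t ≤ N.E.ncard, t + 1 ≤ (arcBall N col x t).ncard := by
      intro t
      induction t with
      | zero => simp [arcBall]
      | succ t ih =>
        intro ht
        have := Set.ncard_lt_ncard
          ((arcBall_mono (N := N) (col := col) (x := x) t.le_succ).ssubset_of_ne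
            (hne t (by omega)).symm) (hfin.subset (arcBall_subset_ground hx _))
        have := ih (by omega)
        simp only [Nat.succ_eq_add_one] at *
        omega
    have h₁ := hcard _ le_rfl
    have h₂ := Set.ncard_le_ncard (arcBall_subset_ground (col := col) hx N.E.ncard) hfin
    omega
  set R := arcBall N col x t with hR
  have hRE : R ⊆ N.E := arcBall_subset_ground hx t
  have hRfin : R.Finite := hfin.subset hRE
  have hclosed : ∀ y ∈ R, ∀ z, IsArc N col y z → z ∈ R := fun y hy z hz => by
    rw [← hstab]; exact Or.inr ⟨y, hy, hz⟩
  -- If `y ∈ R` is not in class `c`, it is no sink for `c` and closes a circuit with the class.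
  -- Every other element of this circuit is the end of an arc from `y`, hence in `R`; so `y` is
  -- spanned by the part of the class inside `R`.
  have hbasis : ∀ c, 1 ≤ c → c ≤ k → N.IsBasis (colorClass N col c ∩ R) R := by
    intro c hc hck
    have hcls := hcol.2 c hc
    refine (hcls.subset Set.inter_subset_left).isBasis_of_subset_of_subset_closure
      Set.inter_subset_right fun y hy => ?_
    by_cases hyc : col y = c
    · exact N.mem_closure_of_mem' ⟨⟨hRE hy, hyc⟩, hy⟩ (hRE hy)
    have hynot : y ∉ colorClass N col c := fun h => hyc h.2
    have hycl : y ∈ N.closure (colorClass N col c) := by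
      rw [hcls.mem_closure_iff_of_notMem hynot]
      exact ⟨fun hi => hno t ht y hy c ⟨hc, hck, hyc, hi⟩,
        Set.insert_subset (hRE hy) hcls.subset_ground⟩
    have hcirc := hcls.fundCircuit_isCircuit hycl hynot
    refine N.closure_subset_closure ?_
      (hcirc.mem_closure_sdiff_singleton_of_mem (N.mem_fundCircuit y _))
    rintro z ⟨hz, hzy⟩
    have hzc : z ∈ colorClass N col c :=
      (N.fundCircuit_subset_insert y _ hz).resolve_left hzy
    refine ⟨hzc, hclosed y hy z ⟨hzc.1, ?_, ?_, ?_⟩⟩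
    · rw [hzc.2]; omega
    · rw [hzc.2]; exact Ne.symm hyc
    · rw [hzc.2]; exact (hcls.mem_fundCircuit_iff hycl hynot).1 hz
  obtain ⟨B, hB⟩ := N.exists_isBasis R hRE
  have hBfin : B.Finite := hRfin.subset hB.subset
  have hrank : ∀ J ⊆ R, N.Indep J → J.ncard ≤ B.ncard := by
    intro J hJR hJ
    obtain ⟨B', hB', hJB'⟩ := hJ.subset_isBasis_of_subset hJR
    calc J.ncard ≤ B'.ncard := Set.ncard_le_ncard hJB' (hRfin.subset hB'.subset)
      _ = B.ncard := by rw [Set.ncard, Set.ncard, hB'.encard_eq_encard hB]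
  have hclass : ∀ c, 1 ≤ c → c ≤ k → (colorClass N col c ∩ R).ncard = B.ncard := by
    intro c hc hck
    rw [Set.ncard, Set.ncard, (hbasis c hc hck).encard_eq_encard hB]
  -- The `k` classes contribute the rank of `R` each; the `+ 1` is the uncolored element `x`.
  have hlow : k * B.ncard + 1 ≤ R.ncard := by
    have hsum : ∑ c ∈ Finset.Icc 1 k, (colorClass N col c ∩ R).ncard = k * B.ncard := by
      rw [Finset.sum_congr rfl fun c hc => hclass c (Finset.mem_Icc.1 hc).1 (Finset.mem_Icc.1 hc).2]
      simp
    have hcard : R.ncard = hRfin.toFinset.card := Set.ncard_eq_toFinset_card R hRfin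
    have hx' : x ∈ hRfin.toFinset := by simpa using mem_arcBall_self x t
    rw [hcard, ← Finset.card_erase_add_one hx', ← hsum]
    have hmaps : ∀ c ∈ Finset.Icc 1 k, (colorClass N col c ∩ R).ncard =
        (((hRfin.toFinset.erase x).filter fun j => col j = c)).card := by
      intro c hc
      rw [← Set.ncard_coe_finset]
      congr 1
      ext j
      have := (Finset.mem_Icc.1 hc).1
      simp only [colorClass, Set.mem_inter_iff, Set.mem_ofPred_eq, Finset.coe_filter,
        Finset.mem_erase, Set.Finite.mem_toFinset]
      constructor
      · rintro ⟨⟨-, h⟩, hj⟩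
        refine ⟨⟨?_, hj⟩, h⟩
        rintro rfl
        omega
      · rintro ⟨⟨-, hj⟩, h⟩
        exact ⟨⟨hRE hj, h⟩, hj⟩
    rw [Finset.sum_congr rfl hmaps, ← Finset.card_biUnion]
    · have : ((Finset.Icc 1 k).biUnion fun c => (hRfin.toFinset.erase x).filter
          fun j => col j = c).card ≤ (hRfin.toFinset.erase x).card :=
        Finset.card_le_card fun j hj => by
          obtain ⟨c, -, hc⟩ := Finset.mem_biUnion.1 hj
          exact (Finset.mem_filter.1 hc).1
      omega
    · intro c _ d _ hcd
      refine Finset.disjoint_left.2 fun j hj hj' => hcd ?_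
      rw [← (Finset.mem_filter.1 hj).2, (Finset.mem_filter.1 hj').2]
  intro g hg
  -- Each class of `g` is independent, so it covers at most `B.ncard` elements of `R`.
  have hup : R.ncard ≤ (g '' N.E).ncard * B.ncard := by
    have hgfin := hfin.image g
    rw [Set.ncard_eq_toFinset_card R hRfin, Set.ncard_eq_toFinset_card _ hgfin,
      Finset.card_eq_sum_card_fiberwise (f := g) (t := hgfin.toFinset)
        (fun j hj => by simpa using ⟨j, hRE (by simpa using hj), rfl⟩), ← smul_eq_mul]
    refine Finset.sum_le_card_nsmul _ _ _ fun c _ => ?_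
    rw [← Set.ncard_coe_finset]
    refine hrank _ (fun j hj => by simpa using (Finset.mem_filter.1 hj).1)
      ((hg c).subset fun j hj => ?_)
    have := Finset.mem_filter.1 hj
    exact ⟨hRE (by simpa using this.1), this.2⟩
  by_contra! hlt
  have := Nat.mul_le_mul_right B.ncard (Nat.lt_succ_iff.1 hlt)
  omega

/-- A new color can be used for an element that is not a loop. -/
theorem isPartialColoring_update_succ [DecidableEq α] {x : α} (hx : N.Indep {x})
    (hcol : IsPartialColoring N col k) :
    IsPartialColoring N (Function.update col x (k + 1)) (k + 1) := by
  refine ⟨fun j => ?_, fun c hc => ?_⟩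
  · rw [Function.update_apply]
    split_ifs
    exacts [le_rfl, (hcol.1 j).trans k.le_succ]
  · by_cases hck : c = k + 1
    · refine hx.subset fun j hj => ?_
      have := hj.2
      by_contra hjx
      rw [Function.update_of_ne hjx] at this
      have := hcol.1 j
      omega
    · rw [colorClass_update_of_ne hck]
      exact (hcol.2 c hc).subset Set.sdiff_subset

end Partition

end Courteous

namespace Courteous

/-! ## The matroid partition program

Register `2` holds the number of colors, register `3` the element that is inserted, registers `8`,
`9`, `10` the result of the search for a sink. Arrays `2`, `3`, `5` hold the coloring, the ball
around the inserted element, and the set whose independence is tested. -/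

namespace ForProg

/-- Test the set of the indices where the expression `e` in register `12` is not zero. -/
def testSet (sz : ℕ) (T : ForProg) (e : Expr) : ForProg :=
  .seq (fill 5 12 sz e) T

/-- Record the element in register `6` if it can get the color after the one in register `7`. -/
def trySink (sz : ℕ) (T : ForProg) : ForProg :=
  .ite (((Expr.var 8).not.and (.read 3 (.var 6))).and
      ((Expr.lt (.var 7) (.var 2)).and
        (Expr.eq (.read 2 (.var 6)) (.add (.var 7) (.const 1))).not))
    (.seq (testSet sz T (.add (.eq (.read 2 (.var 12)) (.add (.var 7) (.const 1)))
        (.eq (.var 12) (.var 6))))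
      (.ite (.var 11) (.seq (.assign 8 (.const 1)) (.seq (.assign 9 (.var 6))
        (.assign 10 (.add (.var 7) (.const 1))))) .skip))
    .skip

/-- Search the current ball for a sink. -/
def findSink (sz : ℕ) (T : ForProg) : ForProg :=
  .forTo 6 sz (.forTo 7 sz (trySink sz T))

/-- Add the element in register `7` to the next ball if there is an arc from the one in
register `6`. -/
def tryArc (sz : ℕ) (T : ForProg) : ForProg :=
  .ite ((Expr.read 3 (.var 6)).and ((Expr.read 2 (.var 7)).and
      (Expr.eq (.read 2 (.var 7)) (.read 2 (.var 6))).not))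
    (.seq (testSet sz T ((Expr.not (.eq (.var 12) (.var 7))).and
        (.add (.eq (.read 2 (.var 12)) (.read 2 (.var 7))) (.eq (.var 12) (.var 6)))))
      (.ite (.var 11) (.write 4 (.var 7) (.const 1)) .skip))
    .skip

/-- Replace the current ball by the next one. -/
def expand (sz : ℕ) (T : ForProg) : ForProg :=
  -- The next ball is built in array `4`, so that arcs are followed only from elements of the
  -- current ball and distances stay exact.
  .seq (fill 4 12 sz (.read 3 (.var 12)))
    (.seq (.forTo 6 sz (.forTo 7 sz (tryArc sz T))) (fill 3 12 sz (.read 4 (.var 12))))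

/-- Search for a sink that is as near to the inserted element as possible. -/
def search (sz : ℕ) (T : ForProg) : ForProg :=
  .seq (fill 3 12 sz (.eq (.var 12) (.var 3))) (.seq (.assign 8 (.const 0))
    (.forTo 5 sz (.ite (Expr.var 8).not (.seq (findSink sz T) (expand sz T)) .skip)))

/-- Recolor a nearest sink. -/
def augment (sz : ℕ) (T : ForProg) : ForProg :=
  .seq (search sz T) (.ite (.var 8) (.write 2 (.var 9) (.var 10)) .skip)

/-- Color the element in register `3`. -/
def insertElement (sz : ℕ) (T : ForProg) : ForProg :=
  .seq (.forTo 4 sz (.ite (.read 2 (.var 3)) .skip (augment sz T)))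
    (.ite (.read 2 (.var 3)) .skip
      (.seq (.assign 2 (.add (.var 2) (.const 1))) (.write 2 (.var 3) (.var 2))))

/-- Partition the matroid whose independent sets are recognized by the program `T`. -/
def partition (sz : ℕ) (T : ForProg) : ForProg :=
  .seq (.forTo 3 sz (insertElement sz T)) (fill 0 12 sz (.read 2 (.var 12)))

/-- Whenever the input is intact, the program `T` writes into register `11` whether the set stored
in array `5` is independent in `N`; it does not interfere with the partition program. -/
structure IsIndepTest (O : Set ℕ → Prop) (N : Matroid ℕ) (sz : ℕ) (s₀ : Memory) (T : ForProg) :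
    Prop where
  wf : T.WellFormed
  regs : ∀ x ∈ T.regs, 11 ≤ x
  arrs : ∀ a ∈ T.arrs, 6 ≤ a
  sz_lt : sz < 2
  mem_ground : ∀ j, j ∈ N.E ↔ j < s₀.var sz
  test : ∀ s, (∀ x < 2, s.var x = s₀.var x) → (∀ a < 2, s.arr a = s₀.arr a) →
    (N.Indep (s.storedSet 5 (s.var sz)) → (T.run O s).var 11 = 1) ∧
      (¬ N.Indep (s.storedSet 5 (s.var sz)) → (T.run O s).var 11 = 0)

/-- The input is intact. -/
def Intact (s₀ s : Memory) : Prop :=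
  (∀ x < 2, s.var x = s₀.var x) ∧ ∀ a < 2, s.arr a = s₀.arr a

theorem Intact.of_agreeOff {s₀ s s' : Memory} (h : Intact s₀ s) {X A : List ℕ}
    (h' : AgreeOff X A s s') (hX : ∀ x ∈ X, 2 ≤ x) (hA : ∀ a ∈ A, 2 ≤ a) : Intact s₀ s' :=
  ⟨fun x hx => (h'.1 x fun hx' => absurd (hX x hx') (by omega)).trans (h.1 x hx),
    fun a ha => (h'.2 a fun ha' => absurd (hA a ha') (by omega)).trans (h.2 a ha)⟩

/-! ### Correctness of the sink search and of the expansion of balls -/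

namespace IsIndepTest

variable {O : Set ℕ → Prop} {N : Matroid ℕ} {sz : ℕ} {s₀ : Memory} {T : ForProg}

theorem notMem_regs (h : IsIndepTest O N sz s₀ T) {x : ℕ} (hx : x < 11) : x ∉ T.regs :=
  fun hx' => absurd (h.regs x hx') (by omega)

theorem notMem_arrs (h : IsIndepTest O N sz s₀ T) {x : ℕ} (hx : x < 6) : x ∉ T.arrs :=
  fun hx' => absurd (h.arrs x hx') (by omega)

theorem two_le_regs (h : IsIndepTest O N sz s₀ T) : ∀ x ∈ T.regs, 2 ≤ x :=
  fun x hx => (by omega : 2 ≤ 11).trans (h.regs x hx)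

theorem two_le_arrs (h : IsIndepTest O N sz s₀ T) : ∀ x ∈ T.arrs, 2 ≤ x :=
  fun x hx => (by omega : 2 ≤ 6).trans (h.arrs x hx)

theorem mem_ground' (h : IsIndepTest O N sz s₀ T) {s : Memory} (hs : Intact s₀ s) {j : ℕ} :
    j ∈ N.E ↔ j < s.var sz := by
  rw [h.mem_ground, hs.1 sz h.sz_lt]

theorem run_testSet (h : IsIndepTest O N sz s₀ T) {s : Memory} (hs : Intact s₀ s) {e : Expr}
    (f : ℕ → ℕ)
    (hf : ∀ s', AgreeOff [12] [5] s s' → s'.var 12 ∈ N.E → e.eval s' = f (s'.var 12)) :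
    (N.Indep {j ∈ N.E | f j ≠ 0} → ((testSet sz T e).run O s).var 11 = 1) ∧
      (¬ N.Indep {j ∈ N.E | f j ≠ 0} → ((testSet sz T e).run O s).var 11 = 0) := by
  set s₁ := (fill 5 12 sz e).run O s with hs₁
  have hag : AgreeOff [12] [5] s s₁ := fill_agreeOff _ _ _ _ s
  have hint : Intact s₀ s₁ := hs.of_agreeOff hag (by simp) (by simp)
  have hset : s₁.storedSet 5 (s₁.var sz) = {j ∈ N.E | f j ≠ 0} := by
    ext j
    simp only [Memory.storedSet, Set.mem_ofPred_eq, ← h.mem_ground' hint]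
    refine and_congr_right fun hj => ?_
    rw [hs₁, run_fill f (fun s' h₁ h₂ => hf s' h₁ ((h.mem_ground' hs).2 h₂))
      ((h.mem_ground' hs).1 hj)]
  have := h.test s₁ hint.1 hint.2
  rwa [hset] at this

theorem trySink_run (h : IsIndepTest O N sz s₀ T) {s : Memory} (hs : Intact s₀ s)
    (hy : s.var 6 ∈ N.E) :
    (s.var 8 ≠ 0 ∨ ¬ (s.arr 3 (s.var 6) ≠ 0 ∧
        IsSink N (s.arr 2) (s.var 2) (s.var 6) (s.var 7 + 1)) →
      ((trySink sz T).run O s).var 8 = s.var 8 ∧ ((trySink sz T).run O s).var 9 = s.var 9 ∧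
        ((trySink sz T).run O s).var 10 = s.var 10) ∧
    (s.var 8 = 0 → s.arr 3 (s.var 6) ≠ 0 →
      IsSink N (s.arr 2) (s.var 2) (s.var 6) (s.var 7 + 1) →
      ((trySink sz T).run O s).var 8 = 1 ∧ ((trySink sz T).run O s).var 9 = s.var 6 ∧
        ((trySink sz T).run O s).var 10 = s.var 7 + 1) := by
  set e : Expr := .add (.eq (.read 2 (.var 12)) (.add (.var 7) (.const 1)))
    (.eq (.var 12) (.var 6)) with he
  have htest := h.run_testSet hs (e := e) (fun j => (if s.arr 2 j = s.var 7 + 1 then 1 else 0) +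
    if j = s.var 6 then 1 else 0) (fun s' hs' _ => by
      simp [he, Expr.eval, hs'.1 6, hs'.1 7, hs'.2 2])
  have hset : {j ∈ N.E | (if s.arr 2 j = s.var 7 + 1 then 1 else 0) +
      (if j = s.var 6 then 1 else 0) ≠ 0} =
      insert (s.var 6) (colorClass N (s.arr 2) (s.var 7 + 1)) := by
    ext j
    simp only [colorClass, Set.mem_ofPred_eq, Set.mem_insert_iff]
    by_cases hj : j = s.var 6
    · simp [hj, hy]
    · simp [hj]
  rw [hset] at htest
  set s₁ := (testSet sz T e).run O s with hs₁
  have hv : ∀ x < 11, s₁.var x = s.var x := fun x hx =>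
    run_var_of_notMem (by simp [testSet, fill, ForProg.regs, h.notMem_regs hx]; omega) s
  have hcond : ((((Expr.var 8).not.and (.read 3 (.var 6))).and
      ((Expr.lt (.var 7) (.var 2)).and
        (Expr.eq (.read 2 (.var 6)) (.add (.var 7) (.const 1))).not)).eval s ≠ 0) ↔
      (s.var 8 = 0 ∧ s.arr 3 (s.var 6) ≠ 0) ∧ s.var 7 < s.var 2 ∧
        s.arr 2 (s.var 6) ≠ s.var 7 + 1 := by
    simp only [Expr.eval_and, Expr.eval_not, Expr.eval_lt, Expr.eval_eq_eq_zero]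
    simp [Expr.eval]
  rw [trySink, run]
  by_cases hc : (s.var 8 = 0 ∧ s.arr 3 (s.var 6) ≠ 0) ∧ s.var 7 < s.var 2 ∧
        s.arr 2 (s.var 6) ≠ s.var 7 + 1
  · rw [if_pos (hcond.2 hc)]
    simp only [run, ← he, ← hs₁]
    by_cases hI : N.Indep (insert (s.var 6) (colorClass N (s.arr 2) (s.var 7 + 1)))
    · have hsink : IsSink N (s.arr 2) (s.var 2) (s.var 6) (s.var 7 + 1) :=
        ⟨by omega, by omega, hc.2.2, hI⟩
      rw [if_pos (by simp [Expr.eval, htest.1 hI])]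
      simp [Expr.eval, hv, hc.1, hsink]
    · have hsink : ¬ IsSink N (s.arr 2) (s.var 2) (s.var 6) (s.var 7 + 1) :=
        fun h => hI h.2.2.2
      rw [if_neg (by simp [Expr.eval, htest.2 hI])]
      simp [hv, hsink]
  · rw [if_neg (mt hcond.1 hc)]
    refine ⟨fun _ => ⟨rfl, rfl, rfl⟩, fun h8 h3 hsink => absurd ⟨⟨h8, h3⟩, ?_, hsink.2.2.1⟩ hc⟩
    exact hsink.2.1

/-- The outcome of a search for a sink, with the set of candidates given by `P`. -/
def SearchResult (N : Matroid ℕ) (s : Memory) (P : ℕ → ℕ → Prop) (s' : Memory) : Prop :=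
  (s'.var 8 = 0 ∧ ∀ y c, P y c → ¬ (s.arr 3 y ≠ 0 ∧ IsSink N (s.arr 2) (s.var 2) y c)) ∨
  (s'.var 8 = 1 ∧ s'.var 9 ∈ N.E ∧ s.arr 3 (s'.var 9) ≠ 0 ∧
    IsSink N (s.arr 2) (s.var 2) (s'.var 9) (s'.var 10))

/-- Colors are enumerated up to `sz` because only registers `0` and `1` may bound loops; `hk`
guarantees that this covers all `k` colors, and larger ones are rejected by `trySink`. -/
theorem findSink_run (h : IsIndepTest O N sz s₀ T) {s : Memory} (hs : Intact s₀ s)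
    (h8 : s.var 8 = 0) (hk : s.var 2 ≤ s.var sz) :
    SearchResult N s (fun y _ => y ∈ N.E) ((findSink sz T).run O s) := by
  have hfin := run_forTo (O := O) (i := 6) (r := sz) (p := .forTo 7 sz (trySink sz T)) (s := s)
    (fun y' => SearchResult N s (fun y _ => y < y')) ?_ ?_
  · refine hfin.imp (fun h' => ⟨h'.1, fun y c hy => h'.2 y c ?_⟩) id
    exact (h.mem_ground' hs).1 hy
  · exact Or.inl ⟨by simpa using h8, fun y c hy => by omega⟩
  intro y hy s₁ hs₁6 hs₁ ih
  have hsz := h.sz_lt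
  have hb : ∀ s', AgreeOff (6 :: (ForProg.forTo 7 sz (trySink sz T)).regs)
      (ForProg.forTo 7 sz (trySink sz T)).arrs s s' →
      Intact s₀ s' ∧ s'.arr 2 = s.arr 2 ∧ s'.arr 3 = s.arr 3 ∧ s'.var 2 = s.var 2 := by
    intro s' hs'
    refine ⟨hs.of_agreeOff hs' ?_ ?_, hs'.2 2 ?_, hs'.2 3 ?_, hs'.1 2 ?_⟩
    · simpa [trySink, testSet, fill, ForProg.regs, or_imp, forall_and] using h.two_le_regs
    · simpa [trySink, testSet, fill, ForProg.arrs] using h.two_le_arrs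
    · simp [trySink, testSet, fill, ForProg.arrs, h.notMem_arrs]
    · simp [trySink, testSet, fill, ForProg.arrs, h.notMem_arrs]
    · simp [trySink, testSet, fill, ForProg.regs, h.notMem_regs]
  have hszs₁ : s₁.var sz = s.var sz := by rw [(hb s₁ hs₁).1.1 sz hsz, hs.1 sz hsz]
  -- The pairs tested so far form a lexicographic prefix. Counter `c'` corresponds to the colors `1,
  -- …, c'`, since register `7` is shifted by one; color `0` is never that of a sink.
  have hin := run_forTo (O := O) (i := 7) (r := sz) (p := trySink sz T) (s := s₁)
    (fun c' => SearchResult N s (fun y' c => y' < y ∨ y' = y ∧ c ≤ c')) ?_ ?_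
  · refine Or.imp (fun h' => ⟨by simpa using h'.1, fun y' c hy' => ?_⟩) (fun h' => by simpa using h') hin
    by_cases hyy : y' < y
    · exact h'.2 y' c (Or.inl hyy)
    · rintro ⟨h₁, h₂⟩
      refine h'.2 y' c (Or.inr ⟨by omega, ?_⟩) ⟨h₁, h₂⟩
      have := h₂.2.1
      omega
  · refine ih.imp (fun h' => ⟨by simpa using h'.1, fun y' c hy' => ?_⟩) (fun h' => by simpa using h')
    rcases hy' with hy' | hy'
    · exact h'.2 y' c hy'
    · rintro ⟨-, h₂⟩
      have := h₂.1
      omega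
  intro c hc s₂ hs₂7 hs₂ ih₂
  have hs₂' := hb s₂ (hs₁.trans (hs₂.mono (by simp [ForProg.regs]) (by simp [ForProg.arrs])))
  have hs₂6 : s₂.var 6 = y := by
    rw [← hs₁6]
    exact hs₂.1 6 (by simp [trySink, testSet, fill, ForProg.regs, h.notMem_regs])
  have hyE : y ∈ N.E := (h.mem_ground' hs).2 hy
  obtain ⟨r₁, r₂⟩ := h.trySink_run hs₂'.1 (hs₂6 ▸ hyE)
  rw [hs₂'.2.1, hs₂'.2.2.1, hs₂'.2.2.2, hs₂6, hs₂7] at r₁ r₂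
  have heq : ∀ x ≠ 7, (((trySink sz T).run O s₂).setVar 7 (c + 1)).var x =
      ((trySink sz T).run O s₂).var x := fun x hx => by simp [hx]
  rcases ih₂ with ⟨z, hno⟩ | ⟨z, hyes⟩
  · by_cases hP : s.arr 3 y ≠ 0 ∧ IsSink N (s.arr 2) (s.var 2) y (c + 1)
    · right
      obtain ⟨q₁, q₂, q₃⟩ := r₂ z hP.1 hP.2
      rw [heq 8 (by omega), heq 9 (by omega), heq 10 (by omega), q₁, q₂, q₃]
      exact ⟨rfl, hyE, hP⟩
    · left
      obtain ⟨q₁, q₂, q₃⟩ := r₁ (Or.inr hP)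
      rw [heq 8 (by omega), q₁]
      refine ⟨z, fun y' c' hy' => ?_⟩
      by_cases hcc : y' = y ∧ c' = c + 1
      · rw [hcc.1, hcc.2]
        exact hP
      · exact hno y' c' (by omega)
  · right
    obtain ⟨q₁, q₂, q₃⟩ := r₁ (Or.inl (by omega))
    rw [heq 8 (by omega), heq 9 (by omega), heq 10 (by omega), q₁, q₂, q₃]
    exact ⟨z, hyes⟩

theorem tryArc_run (h : IsIndepTest O N sz s₀ T) {s : Memory} (hs : Intact s₀ s)
    (hy : s.var 6 ∈ N.E) (hz : s.var 7 ∈ N.E) (z : ℕ) :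
    ((tryArc sz T).run O s).arr 4 z ≠ 0 ↔ s.arr 4 z ≠ 0 ∨
      z = s.var 7 ∧ s.arr 3 (s.var 6) ≠ 0 ∧ IsArc N (s.arr 2) (s.var 6) (s.var 7) := by
  set e : Expr := (Expr.not (.eq (.var 12) (.var 7))).and
    (.add (.eq (.read 2 (.var 12)) (.read 2 (.var 7))) (.eq (.var 12) (.var 6))) with he
  have heval : ∀ s', AgreeOff [12] [5] s s' → (e.eval s' ≠ 0 ↔
      s'.var 12 ≠ s.var 7 ∧ (s.arr 2 (s'.var 12) = s.arr 2 (s.var 7) ∨ s'.var 12 = s.var 6)) := by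
    intro s' hs'
    rw [he, Expr.eval_and, Expr.eval_not]
    simp [Expr.eval, hs'.1 6, hs'.1 7, hs'.2 2]
    tauto
  have hval : ∀ s', AgreeOff [12] [5] s s' → e.eval s' ≤ 1 := by
    intro s' _
    rw [he, Expr.and, Expr.not, Expr.eval]
    split_ifs <;> omega
  have htest := h.run_testSet hs (e := e) (fun j => if j ≠ s.var 7 ∧
    (s.arr 2 j = s.arr 2 (s.var 7) ∨ j = s.var 6) then 1 else 0) (fun s' hs' _ => by
      have h₁ := heval s' hs'
      have h₂ := hval s' hs'
      split_ifs with h₃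
      · have := h₁.2 h₃
        omega
      · exact not_not.1 (mt h₁.1 h₃))
  set s₁ := (testSet sz T e).run O s with hs₁
  have hv : ∀ x < 11, s₁.var x = s.var x := fun x hx =>
    run_var_of_notMem (by simp [testSet, fill, ForProg.regs, h.notMem_regs hx]; omega) s
  have ha : s₁.arr 4 = s.arr 4 :=
    run_arr_of_notMem (by simp [testSet, fill, ForProg.arrs, h.notMem_arrs]) s
  have hcond : (((Expr.read 3 (.var 6)).and ((Expr.read 2 (.var 7)).and
      (Expr.eq (.read 2 (.var 7)) (.read 2 (.var 6))).not)).eval s ≠ 0) ↔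
      s.arr 3 (s.var 6) ≠ 0 ∧ s.arr 2 (s.var 7) ≠ 0 ∧ s.arr 2 (s.var 7) ≠ s.arr 2 (s.var 6) := by
    simp only [Expr.eval_and, Expr.eval_not, Expr.eval_eq_eq_zero]
    simp [Expr.eval]
  rw [tryArc, run]
  by_cases hc : s.arr 3 (s.var 6) ≠ 0 ∧ s.arr 2 (s.var 7) ≠ 0 ∧
      s.arr 2 (s.var 7) ≠ s.arr 2 (s.var 6)
  · rw [if_pos (hcond.2 hc)]
    simp only [run, ← he, ← hs₁]
    have hset : {j ∈ N.E | (if j ≠ s.var 7 ∧ (s.arr 2 j = s.arr 2 (s.var 7) ∨ j = s.var 6)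
        then 1 else 0) ≠ 0} =
        insert (s.var 6) (colorClass N (s.arr 2) (s.arr 2 (s.var 7))) \ {s.var 7} := by
      ext j
      have : j = s.var 6 → j ∈ N.E := fun hj => hj ▸ hy
      simp only [colorClass, Set.mem_ofPred_eq, Set.mem_insert_iff, Set.mem_sdiff,
        Set.mem_singleton_iff]
      split_ifs <;> grind
    rw [hset] at htest
    by_cases hI : N.Indep (insert (s.var 6)
        (colorClass N (s.arr 2) (s.arr 2 (s.var 7))) \ {s.var 7})
    · rw [if_pos (by simp [Expr.eval, htest.1 hI])]
      have : IsArc N (s.arr 2) (s.var 6) (s.var 7) := ⟨hz, hc.2.1, hc.2.2, hI⟩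
      simp [Expr.eval, hv, ha, hc.1, this]
      split_ifs <;> simp_all
    · rw [if_neg (by simp [Expr.eval, htest.2 hI])]
      have : ¬ IsArc N (s.arr 2) (s.var 6) (s.var 7) := fun h => hI h.2.2.2
      simp [ha, this]
  · rw [if_neg (mt hcond.1 hc), run]
    refine (or_iff_left ?_).symm
    rintro ⟨-, h₁, h₂⟩
    exact hc ⟨h₁, h₂.2.1, h₂.2.2.1⟩

theorem expand_run (h : IsIndepTest O N sz s₀ T) {s : Memory} (hs : Intact s₀ s) {z : ℕ}
    (hz : z ∈ N.E) : ((expand sz T).run O s).arr 3 z ≠ 0 ↔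
      s.arr 3 z ≠ 0 ∨ ∃ y ∈ N.E, s.arr 3 y ≠ 0 ∧ IsArc N (s.arr 2) y z := by
  have hsz := h.sz_lt
  set s₁ := (fill 4 12 sz (.read 3 (.var 12))).run O s with hs₁
  have hag₁ : AgreeOff [12] [4] s s₁ := fill_agreeOff _ _ _ _ s
  have hint₁ : Intact s₀ s₁ := hs.of_agreeOff hag₁ (by simp) (by simp)
  have hs₁4 : ∀ z ∈ N.E, s₁.arr 4 z = s.arr 3 z := fun z hz =>
    run_fill (s.arr 3) (fun s' hs' _ => by simp [Expr.eval, hs'.2 3]) ((h.mem_ground' hs).1 hz)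
  have hs₁3 : s₁.arr 3 = s.arr 3 := hag₁.2 3 (by simp)
  have hs₁2 : s₁.arr 2 = s.arr 2 := hag₁.2 2 (by simp)
  set p₂ : ForProg := .forTo 6 sz (.forTo 7 sz (tryArc sz T)) with hp₂
  set s₂ := p₂.run O s₁ with hs₂
  have hX : ∀ x ∈ p₂.regs, 2 ≤ x := by
    simpa [hp₂, tryArc, testSet, fill, ForProg.regs] using h.two_le_regs
  have hA : ∀ x ∈ p₂.arrs, 2 ≤ x := by
    simpa [hp₂, tryArc, testSet, fill, ForProg.arrs, or_imp, forall_and] using h.two_le_arrs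
  have hb : ∀ s', AgreeOff p₂.regs p₂.arrs s₁ s' →
      Intact s₀ s' ∧ s'.arr 2 = s.arr 2 ∧ s'.arr 3 = s.arr 3 := by
    intro s' hs'
    refine ⟨hint₁.of_agreeOff hs' hX hA, (hs'.2 2 ?_).trans hs₁2, (hs'.2 3 ?_).trans hs₁3⟩
    · simp [hp₂, tryArc, testSet, fill, ForProg.arrs, h.notMem_arrs]
    · simp [hp₂, tryArc, testSet, fill, ForProg.arrs, h.notMem_arrs]
  have hint₂ := hb s₂ (run_agreeOff p₂ s₁)
  have hfin : ∀ z ∈ N.E, s₂.arr 4 z ≠ 0 ↔ s.arr 3 z ≠ 0 ∨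
      ∃ y < s₁.var sz, s.arr 3 y ≠ 0 ∧ IsArc N (s.arr 2) y z := by
    refine run_forTo (O := O) (i := 6) (r := sz) (p := .forTo 7 sz (tryArc sz T)) (s := s₁)
      (fun y' s' => ∀ z ∈ N.E, s'.arr 4 z ≠ 0 ↔ s.arr 3 z ≠ 0 ∨
        ∃ y < y', s.arr 3 y ≠ 0 ∧ IsArc N (s.arr 2) y z) ?_ ?_
    · intro z hz
      simp [hs₁4 z hz]
    intro y hy s₃ hs₃6 hs₃ ih
    have hyE : y ∈ N.E := (h.mem_ground' hint₁).2 hy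
    have hszs₃ : s₃.var sz = s₁.var sz := by rw [(hb s₃ hs₃).1.1 sz hsz, hint₁.1 sz hsz]
    have hin := run_forTo (O := O) (i := 7) (r := sz) (p := tryArc sz T) (s := s₃)
      (fun z' s' => ∀ z ∈ N.E, s'.arr 4 z ≠ 0 ↔ (s.arr 3 z ≠ 0 ∨
        ∃ y' < y, s.arr 3 y' ≠ 0 ∧ IsArc N (s.arr 2) y' z) ∨
        z < z' ∧ s.arr 3 y ≠ 0 ∧ IsArc N (s.arr 2) y z) ?_ ?_
    · intro z hz
      rw [Memory.setVar_arr, hin z hz, hszs₃, ← h.mem_ground' hint₁]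
      simp only [Nat.lt_succ_iff_lt_or_eq, or_and_right, exists_or, exists_eq_left, hz, true_and,
        or_assoc]
    · intro z hz
      simpa using ih z hz
    intro z' hz' s₄ hs₄7 hs₄ ih₄ z hz
    have hs₄' := hb s₄ (hs₃.trans (hs₄.mono (by simp [ForProg.regs])
      (by simp [ForProg.arrs])))
    have hs₄6 : s₄.var 6 = y := by
      rw [← hs₃6]
      exact hs₄.1 6 (by simp [tryArc, testSet, fill, ForProg.regs, h.notMem_regs])
    rw [Memory.setVar_arr, h.tryArc_run hs₄'.1 (hs₄6 ▸ hyE)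
      (hs₄7 ▸ (h.mem_ground' hint₁).2 (hszs₃ ▸ hz')), ih₄ z hz, hs₄'.2.1, hs₄'.2.2, hs₄6, hs₄7,
      Nat.lt_succ_iff_lt_or_eq]
    grind
  have hlast : ((expand sz T).run O s).arr 3 z = s₂.arr 4 z :=
    run_fill (s := s₂) (s₂.arr 4) (fun s' hs' _ => by simp [Expr.eval, hs'.2 4])
      ((h.mem_ground' hint₂.1).1 hz)
  rw [hlast, hfin z hz]
  simp only [h.mem_ground' hint₁]

end IsIndepTest

end ForProg

end Courteous

/-! ### Correctness of the nearest-sink search and of the augmentation -/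

namespace Courteous
namespace ForProg
namespace IsIndepTest

variable {O : Set ℕ → Prop} {N : Matroid ℕ} {sz : ℕ} {s₀ : Memory} {T : ForProg}

/-- The outcome of the search for a nearest sink: either none is near, or a nearest one has been
recorded. -/
def NearestSink (N : Matroid ℕ) (s : Memory) (n : ℕ) (s' : Memory) : Prop :=
  (s'.var 8 = 0 ∧ ∀ t < n, ∀ y ∈ arcBall N (s.arr 2) (s.var 3) t,
    ∀ c, ¬ IsSink N (s.arr 2) (s.var 2) y c) ∨
  (s'.var 8 = 1 ∧ ∃ t < n, s'.var 9 ∈ arcBall N (s.arr 2) (s.var 3) t ∧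
    IsSink N (s.arr 2) (s.var 2) (s'.var 9) (s'.var 10) ∧
    ∀ t' < t, ∀ y ∈ arcBall N (s.arr 2) (s.var 3) t',
      ∀ c, ¬ IsSink N (s.arr 2) (s.var 2) y c)

theorem search_regs (h : IsIndepTest O N sz s₀ T) {x : ℕ} (hx : x < 5) :
    x ∉ (search sz T).regs := by
  simp [search, findSink, expand, trySink, tryArc, testSet, fill, ForProg.regs,
    h.notMem_regs (show x < 11 by omega)]
  omega

theorem search_arrs (h : IsIndepTest O N sz s₀ T) {x : ℕ} (hx : x < 3) :
    x ∉ (search sz T).arrs := by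
  simp [search, findSink, expand, trySink, tryArc, testSet, fill, ForProg.arrs,
    h.notMem_arrs (show x < 6 by omega)]
  omega

/-- Radius `t` is searched completely before the ball of radius `t + 1` is formed, so the first sink
found is a nearest one. Afterwards the rounds are idle, which is why the ball is controlled only
while register `8` is `0`. -/
theorem search_run (h : IsIndepTest O N sz s₀ T) {s : Memory} (hs : Intact s₀ s)
    (hx : s.var 3 ∈ N.E) (hk : s.var 2 ≤ s.var sz) :
    NearestSink N s (s.var sz) ((search sz T).run O s) := by
  have hsz := h.sz_lt
  set s₁ := (fill 3 12 sz (.eq (.var 12) (.var 3))).run O s with hs₁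
  have hag₁ : AgreeOff [12] [3] s s₁ := fill_agreeOff _ _ _ _ s
  set s₂ := s₁.setVar 8 0 with hs₂
  have hs₂3 : ∀ z ∈ N.E, s₂.arr 3 z ≠ 0 ↔ z = s.var 3 := by
    intro z hz
    have : s₁.arr 3 z = if z = s.var 3 then 1 else 0 :=
      run_fill (fun j => if j = s.var 3 then 1 else 0)
        (fun s' hs' _ => by simp [Expr.eval, hs'.1 3]) ((h.mem_ground' hs).1 hz)
    rw [hs₂, Memory.setVar_arr, this]
    simp
  have hag₂ : AgreeOff [12, 8] [3] s s₂ := (hag₁.mono (by simp) (by simp)).setVar (by simp) 0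
  set p : ForProg := .ite (Expr.var 8).not (.seq (findSink sz T) (expand sz T)) .skip with hp
  have hregs : ∀ x < 5, x ∉ (5 :: p.regs) := by
    intro x hx
    simp [hp, findSink, expand, trySink, tryArc, testSet, fill, ForProg.regs,
      h.notMem_regs (show x < 11 by omega)]
    omega
  have harrs : ∀ x < 3, x ∉ p.arrs := by
    intro x hx
    simp [hp, findSink, expand, trySink, tryArc, testSet, fill, ForProg.arrs,
      h.notMem_arrs (show x < 6 by omega)]
    omega
  have hint₂ : ∀ s', AgreeOff (5 :: p.regs) p.arrs s₂ s' →
      Intact s₀ s' ∧ s'.arr 2 = s.arr 2 ∧ s'.var 2 = s.var 2 := by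
    intro s' hs'
    refine ⟨⟨fun x hx => ?_, fun a ha => ?_⟩, ?_, ?_⟩
    · rw [hs'.1 x (hregs x (by omega)), hag₂.1 x (by simp; omega), hs.1 x hx]
    · rw [hs'.2 a (harrs a (by omega)), hag₂.2 a (by simp; omega), hs.2 a ha]
    · rw [hs'.2 2 (harrs 2 (by omega)), hag₂.2 2 (by simp)]
    · rw [hs'.1 2 (hregs 2 (by omega)), hag₂.1 2 (by simp)]
  have hszs₂ : s₂.var sz = s.var sz := hag₂.1 sz (by simp; omega)
  have hfin := run_forTo (O := O) (i := 5) (r := sz) (p := p) (s := s₂)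
    (fun t s' => NearestSink N s t s' ∧ (s'.var 8 = 0 →
      ∀ z ∈ N.E, s'.arr 3 z ≠ 0 ↔ z ∈ arcBall N (s.arr 2) (s.var 3) t)) ?_ ?_
  · rw [hszs₂] at hfin
    exact hfin.1
  · exact ⟨Or.inl ⟨by simp [hs₂], fun t ht => absurd ht (by omega)⟩,
      fun _ z hz => hs₂3 z hz⟩
  rintro t ht s₃ hs₃5 hs₃ ⟨ih, ihball⟩
  obtain ⟨hint₃, hs₃2, hs₃k⟩ := hint₂ s₃ hs₃
  rcases ih with ⟨z, hno⟩ | ⟨z, hyes⟩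
  · have hball := ihball z
    have hrun : p.run O s₃ = (expand sz T).run O ((findSink sz T).run O s₃) := by
      rw [hp, run, if_pos (by simp [Expr.eval, z])]
      rfl
    set s₄ := (findSink sz T).run O s₃ with hs₄
    have hf := h.findSink_run hint₃ z (by
      rw [hs₃k, hint₃.1 sz hsz, ← hs.1 sz hsz]; exact hk)
    have hag₄ : AgreeOff (findSink sz T).regs (findSink sz T).arrs s₃ s₄ := run_agreeOff _ s₃
    have hfregs : ∀ x ∈ (findSink sz T).regs, 2 ≤ x := by
      simpa [findSink, trySink, testSet, fill, ForProg.regs, or_imp, forall_and]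
        using h.two_le_regs
    have hfarrs : ∀ x ∈ (findSink sz T).arrs, 5 ≤ x := by
      simpa [findSink, trySink, testSet, fill, ForProg.arrs]
        using fun x hx => (by omega : 5 ≤ 6).trans (h.arrs x hx)
    have hint₄ : Intact s₀ s₄ := hint₃.of_agreeOff hag₄ hfregs
      fun x hx => (by omega : 2 ≤ 5).trans (hfarrs x hx)
    have hs₄3 : s₄.arr 3 = s₃.arr 3 := hag₄.2 3 fun hx => absurd (hfarrs 3 hx) (by omega)
    have hs₄2 : s₄.arr 2 = s.arr 2 :=
      (hag₄.2 2 fun hx => absurd (hfarrs 2 hx) (by omega)).trans hs₃2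
    have hev : ∀ x, 8 ≤ x → x ≤ 10 → ((expand sz T).run O s₄).var x = s₄.var x := by
      intro x hx hx'
      refine run_var_of_notMem ?_ s₄
      simp [expand, tryArc, testSet, fill, ForProg.regs, h.notMem_regs (show x < 11 by omega)]
      omega
    have hballE := arcBall_subset_ground (N := N) (col := s.arr 2) hx
    rw [hrun]
    refine ⟨?_, fun _ w hw => ?_⟩
    · rcases hf with ⟨q₁, q₂⟩ | ⟨q₁, q₂, q₃, q₄⟩
      · left
        refine ⟨by simpa [hev 8] using q₁, fun t' ht' y hy c hyc => ?_⟩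
        rcases Nat.lt_succ_iff_lt_or_eq.1 ht' with ht' | rfl
        · exact hno t' ht' y hy c hyc
        · refine q₂ y c (hballE _ hy) ⟨(hball y (hballE _ hy)).2 hy, ?_⟩
          rwa [hs₃2, hs₃k]
      · right
        simp only [Memory.setVar_var, show (8 : ℕ) ≠ 5 by omega, show (9 : ℕ) ≠ 5 by omega,
          show (10 : ℕ) ≠ 5 by omega, if_false, hev 8 (by omega) (by omega),
          hev 9 (by omega) (by omega), hev 10 (by omega) (by omega)]
        rw [hs₃2, hs₃k] at q₄
        exact ⟨q₁, t, by omega, (hball _ q₂).1 q₃, q₄, hno⟩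
    · rw [Memory.setVar_arr, h.expand_run hint₄ hw, hs₄3, hs₄2, hball w hw]
      refine or_congr_right ⟨?_, ?_⟩
      · rintro ⟨y, hy, hy3, hyw⟩
        exact ⟨y, (hball y hy).1 hy3, hyw⟩
      · rintro ⟨y, hy, hyw⟩
        exact ⟨y, hballE _ hy, (hball y (hballE _ hy)).2 hy, hyw⟩
  · have hrun : p.run O s₃ = s₃ := by
      rw [hp, run, if_neg (by simp only [ne_eq, not_not, Expr.eval_not_eq_zero]; simp [Expr.eval, z])]
      rfl
    obtain ⟨t', ht', hyes⟩ := hyes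
    rw [hrun]
    refine ⟨Or.inr ⟨by simp [z], t', by omega, by simpa using hyes⟩, fun h8 => ?_⟩
    simp [z] at h8

theorem augment_run (h : IsIndepTest O N sz s₀ T) {s : Memory} (hs : Intact s₀ s)
    (hx : s.var 3 ∈ N.E) (hk : s.var 2 ≤ s.var sz) :
    ((∀ t < s.var sz, ∀ y ∈ arcBall N (s.arr 2) (s.var 3) t,
        ∀ c, ¬ IsSink N (s.arr 2) (s.var 2) y c) ∧
      ((augment sz T).run O s).arr 2 = s.arr 2) ∨
    ∃ t < s.var sz, ∃ y ∈ arcBall N (s.arr 2) (s.var 3) t, ∃ c,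
      IsSink N (s.arr 2) (s.var 2) y c ∧
      (∀ t' < t, ∀ y ∈ arcBall N (s.arr 2) (s.var 3) t',
        ∀ c, ¬ IsSink N (s.arr 2) (s.var 2) y c) ∧
      ((augment sz T).run O s).arr 2 = Function.update (s.arr 2) y c := by
  have h2 : ((search sz T).run O s).arr 2 = s.arr 2 :=
    run_arr_of_notMem (h.search_arrs (by omega)) s
  rcases h.search_run hs hx hk with ⟨z, hno⟩ | ⟨z, t, ht, hy, hyc, hno⟩
  · refine Or.inl ⟨hno, ?_⟩
    rw [augment, run, run, if_neg (by simp [Expr.eval, z]), run, h2]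
  · refine Or.inr ⟨t, ht, _, hy, _, hyc, hno, ?_⟩
    rw [augment, run, run, if_pos (by simp [Expr.eval, z]), run, Memory.setArr_arr, if_pos rfl, h2]
    rfl

/-- The coloring after a number of augmentations: the element `x` has been colored, or no sink can
be reached, or one is near. -/
def AugmentState (N : Matroid ℕ) (k x n r : ℕ) (col : ℕ → ℕ) : Prop :=
  IsPartialColoring N col k ∧ (∀ j ∈ N.E, j ≠ x → (col j ≠ 0 ↔ j < x)) ∧
    (col x ≠ 0 ∨ (∀ t < n, ∀ y ∈ arcBall N col x t, ∀ c, ¬ IsSink N col k y c) ∨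
      ∃ t < r, ∃ y ∈ arcBall N col x t, ∃ c, IsSink N col k y c)

/-- A nearest sink lies at distance at most `r`. If the distance is `0`, the sink is `x` itself,
which gets colored; otherwise a sink is closer afterwards, which lowers the bound by one. -/
theorem AugmentState.update {k x n r : ℕ} {col : ℕ → ℕ} (hcol : AugmentState N k x n (r + 1) col)
    (hx : x ∈ N.E) (hx0 : col x = 0) {t y c : ℕ} (ht : t < n)
    (hy : y ∈ arcBall N col x t) (hyc : IsSink N col k y c)
    (hno : ∀ t' < t, ∀ y ∈ arcBall N col x t', ∀ c, ¬ IsSink N col k y c) :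
    AugmentState N k x n r (Function.update col y c) := by
  obtain ⟨hc, hother, hst⟩ := hcol
  have hyE := arcBall_subset_ground hx _ hy
  have hc0 : c ≠ 0 := Nat.one_le_iff_ne_zero.1 hyc.1
  refine ⟨hyc.isPartialColoring_update hyE hc, fun j hj hjx => ?_, ?_⟩
  · by_cases hjy : j = y
    · subst hjy
      have : col j ≠ 0 := (eq_or_col_ne_zero_of_mem_arcBall hy).resolve_left hjx
      simp [hc0, (hother j hj hjx).1 this]
    · rw [Function.update_of_ne hjy, hother j hj hjx]
  · have htr : t ≤ r := by
      rcases hst with hst | hst | ⟨t', ht', y', hy', c', hyc'⟩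
      · exact absurd hx0 hst
      · exact absurd hyc (hst t ht y hy c)
      · by_contra! htr
        exact hno t' (by omega) y' hy' c' hyc'
    cases t with
    | zero =>
      obtain rfl : y = x := hy
      exact Or.inl (by simpa using hc0)
    | succ t =>
      exact Or.inr (Or.inr ⟨t, by omega, exists_isSink_update hx hc hy hyc (hno t (by omega))⟩)

theorem augment_regs (h : IsIndepTest O N sz s₀ T) {x : ℕ} (hx : x < 5) :
    x ∉ (augment sz T).regs := by
  simpa [augment, ForProg.regs] using h.search_regs hx

theorem augment_arrs (h : IsIndepTest O N sz s₀ T) {x : ℕ} (hx : x < 2) :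
    x ∉ (augment sz T).arrs := by
  simpa [augment, ForProg.arrs, h.search_arrs (show x < 3 by omega)] using by omega

/-- The distance bound is at most `n` initially and drops in each of the `n` rounds until `x` is
colored or no sink is reachable. In the latter case a new color is opened, and `needsColors_succ`
certifies that it is unavoidable. -/
theorem insertElement_run (h : IsIndepTest O N sz s₀ T) [N.Finite] (hN : ∀ x ∈ N.E, N.Indep {x})
    {s : Memory} (hs : Intact s₀ s) (hx : s.var 3 ∈ N.E) (hk : s.var 2 ≤ s.var 3)
    (hcol : IsPartialColoring N (s.arr 2) (s.var 2)) (hneed : NeedsColors N (s.var 2))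
    (hdone : ∀ j ∈ N.E, s.arr 2 j ≠ 0 ↔ j < s.var 3) :
    ∃ s', (insertElement sz T).run O s = s' ∧ s'.var 2 ≤ s.var 3 + 1 ∧
      IsPartialColoring N (s'.arr 2) (s'.var 2) ∧ NeedsColors N (s'.var 2) ∧
      ∀ j ∈ N.E, s'.arr 2 j ≠ 0 ↔ j < s.var 3 + 1 := by
  have hsz := h.sz_lt
  have hxsz := (h.mem_ground' hs).1 hx
  set x := s.var 3 with hxs
  set k := s.var 2 with hks
  set n := s.var sz with hn
  set p : ForProg := .ite (.read 2 (.var 3)) .skip (augment sz T) with hp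
  have hkeep : ∀ s', AgreeOff (4 :: p.regs) p.arrs s s' → Intact s₀ s' ∧ s'.var 2 = k ∧
      s'.var 3 = x ∧ s'.var sz = n := by
    intro s' hs'
    have hv : ∀ y < 4, s'.var y = s.var y := fun y hy => hs'.1 y (by
      simp [hp, ForProg.regs, h.augment_regs (show y < 5 by omega)]; omega)
    refine ⟨⟨fun y hy => (hv y (by omega)).trans (hs.1 y hy), fun a ha => ?_⟩, hv 2 (by omega),
      hv 3 (by omega), hv sz (by omega)⟩
    refine (hs'.2 a ?_).trans (hs.2 a ha)
    simp [hp, ForProg.arrs, h.augment_arrs ha]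
  set s₁ := (ForProg.forTo 4 sz p).run O s with hs₁
  -- The bound is `n - j` after `j` rounds; with `n - n = 0` the alternative of a near sink is void.
  have hloop : AugmentState N k x n (n - n) (s₁.arr 2) := by
    refine run_forTo (O := O) (i := 4) (r := sz) (p := p) (s := s)
      (fun j s' => AugmentState N k x n (n - j) (s'.arr 2)) ⟨hcol, ?_, ?_⟩ ?_
    · exact fun j hj _ => hdone j hj
    · right
      by_contra! hcon
      obtain ⟨⟨t, ht, y, hy, c, hyc⟩, hno⟩ := hcon
      exact hno t (by omega) y hy c hyc
    intro j hj s' _ hs' ih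
    obtain ⟨hint', h2', h3', hsz'⟩ := hkeep s' hs'
    rw [Memory.setVar_arr, hp, run]
    by_cases hx0 : s'.arr 2 x = 0
    · rw [if_neg (by simp [Expr.eval, h3', hx0])]
      have haug := h.augment_run hint' (by rwa [h3']) (by rw [h2', hsz']; omega)
      rw [h2', h3', hsz'] at haug
      rcases haug with ⟨hno, heq⟩ | ⟨t, ht, y, hy, c, hyc, hno, heq⟩
      · rw [heq]
        exact ⟨ih.1, ih.2.1, Or.inr (Or.inl hno)⟩
      · rw [heq]
        rw [show n - j = n - (j + 1) + 1 by omega] at ih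
        exact ih.update hx hx0 ht hy hyc hno
    · rw [if_pos (by simp [Expr.eval, h3', hx0])]
      exact ⟨ih.1, ih.2.1, Or.inl hx0⟩
  have hag₁ : AgreeOff (4 :: p.regs) p.arrs s s₁ := run_agreeOff (.forTo 4 sz p) s
  obtain ⟨-, h2', h3', -⟩ := hkeep s₁ hag₁
  obtain ⟨hcol₁, hother, hst⟩ := hloop
  refine ⟨_, rfl, ?_⟩
  rw [insertElement, run, ← hp, ← hs₁, run]
  by_cases hx0 : s₁.arr 2 x = 0
  · rw [if_neg (by simp [Expr.eval, h3', hx0])]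
    have hno : ∀ t < n, ∀ y ∈ arcBall N (s₁.arr 2) x t, ∀ c, ¬ IsSink N (s₁.arr 2) k y c := by
      rcases hst with hst | hst | ⟨t, ht, -⟩
      · exact absurd hx0 hst
      · exact hst
      · omega
    have hcard : N.E.ncard = n := by
      have : N.E = Set.Iio n := Set.ext fun j => h.mem_ground' hs
      rw [this, Set.ncard_eq_toFinset_card', Set.toFinset_Iio, Nat.card_Iio]
    have hnew : (((ForProg.assign 2 ((Expr.var 2).add (.const 1))).seq
        (.write 2 (.var 3) (.var 2))).run O s₁).arr 2 =
        Function.update (s₁.arr 2) x (k + 1) := by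
      simp [run, Memory.setArr_arr, Expr.eval, h2', h3']
    have hnewk : (((ForProg.assign 2 ((Expr.var 2).add (.const 1))).seq
        (.write 2 (.var 3) (.var 2))).run O s₁).var 2 = k + 1 := by
      simp [run, Expr.eval, h2']
    rw [hnew, hnewk]
    refine ⟨by omega, isPartialColoring_update_succ (hN x hx) hcol₁,
      needsColors_succ hx hx0 hcol₁ (by rwa [hcard]), fun j hj => ?_⟩
    by_cases hjx : j = x
    · simp [hjx]
    · rw [Function.update_of_ne hjx, hother j hj hjx]
      omega
  · rw [if_pos (by simp [Expr.eval, h3', hx0]), run, h2']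
    refine ⟨by omega, hcol₁, hneed, fun j hj => ?_⟩
    by_cases hjx : j = x
    · simp [hjx, hx0]
    · rw [hother j hj hjx]
      omega

theorem partition_run (h : IsIndepTest O N sz s₀ T) [N.Finite] (hN : ∀ x ∈ N.E, N.Indep {x})
    (hk : s₀.var 2 = 0) (hcol : ∀ j, s₀.arr 2 j = 0) :
    ∃ k, NeedsColors N k ∧
      (∀ c, N.Indep (colorClass N (((partition sz T).run O s₀).arr 0) c)) ∧
      ∀ j ∈ N.E, ((partition sz T).run O s₀).arr 0 j ∈ Finset.Icc 1 k := by
  have hsz := h.sz_lt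
  set n := s₀.var sz with hn
  have hregs : ∀ x < 2, x ∉ (3 :: (insertElement sz T).regs) := by
    intro x hx
    simp [insertElement, ForProg.regs, h.augment_regs (show x < 5 by omega)]
    omega
  have harrs : ∀ x < 2, x ∉ (insertElement sz T).arrs := by
    intro x hx
    simp [insertElement, ForProg.arrs, h.augment_arrs hx]
    omega
  have hkeep : ∀ s', AgreeOff (3 :: (insertElement sz T).regs) (insertElement sz T).arrs s₀ s' →
      Intact s₀ s' := fun s' hs' =>
    ⟨fun x hx => hs'.1 x (hregs x hx), fun a ha => hs'.2 a (harrs a ha)⟩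
  set s₁ := (ForProg.forTo 3 sz (insertElement sz T)).run O s₀ with hs₁
  have hint₁ : Intact s₀ s₁ := hkeep s₁ (run_agreeOff (.forTo 3 sz (insertElement sz T)) s₀)
  obtain ⟨-, hcol₁, hneed, hdone⟩ : s₁.var 2 ≤ n ∧ IsPartialColoring N (s₁.arr 2) (s₁.var 2) ∧
      NeedsColors N (s₁.var 2) ∧ ∀ j ∈ N.E, s₁.arr 2 j ≠ 0 ↔ j < n := by
    refine run_forTo (O := O) (i := 3) (r := sz) (p := insertElement sz T) (s := s₀)
      (fun x s' => s'.var 2 ≤ x ∧ IsPartialColoring N (s'.arr 2) (s'.var 2) ∧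
        NeedsColors N (s'.var 2) ∧ ∀ j ∈ N.E, s'.arr 2 j ≠ 0 ↔ j < x) ?_ ?_
    · refine ⟨by simp [hk], ⟨by simp [hcol], fun c hc => ?_⟩, ?_, by simp [hcol]⟩
      · convert N.empty_indep
        refine Set.eq_empty_of_forall_notMem fun j hj => ?_
        have := hj.2
        simp only [Memory.setVar_arr, hcol] at this
        omega
      · intro g _
        simp [hk]
    rintro x hx s' rfl hs' ⟨ih₁, ih₂, ih₃, ih₄⟩
    obtain ⟨s'', rfl, h₁, h₂, h₃, h₄⟩ := h.insertElement_run hN (hkeep s' hs')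
      ((h.mem_ground _).2 hx) ih₁ ih₂ ih₃ ih₄
    have := And.intro h₁ (And.intro h₂ (And.intro h₃ h₄))
    simpa using this
  have hfinal : ∀ j ∈ N.E, ((partition sz T).run O s₀).arr 0 j = s₁.arr 2 j := fun j hj =>
    run_fill (s := s₁) (s₁.arr 2) (fun s' hs' _ => by simp [Expr.eval, hs'.2 2])
      ((h.mem_ground' hint₁).1 hj)
  -- No element is left uncolored, so class `0` is empty and every class is independent.
  have hpos : ∀ j ∈ N.E, 1 ≤ s₁.arr 2 j := fun j hj =>
    Nat.one_le_iff_ne_zero.2 ((hdone j hj).2 ((h.mem_ground j).1 hj))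
  refine ⟨s₁.var 2, hneed, fun c => ?_, fun j hj => ?_⟩
  · have : colorClass N (((partition sz T).run O s₀).arr 0) c = colorClass N (s₁.arr 2) c := by
      ext j
      exact and_congr_right fun hj => by rw [hfinal j hj]
    rw [this]
    rcases Nat.eq_zero_or_pos c with rfl | hc
    · convert N.empty_indep
      refine Set.eq_empty_of_forall_notMem fun j hj => ?_
      have := hpos j hj.1
      have := hj.2
      omega
    · exact hcol₁.2 c hc
  · rw [hfinal j hj]
    exact Finset.mem_Icc.2 ⟨hpos j hj, hcol₁.1 j⟩

theorem partition_wellFormed (h : IsIndepTest O N sz s₀ T) : (partition sz T).WellFormed := by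
  have := h.sz_lt
  simp [partition, insertElement, augment, search, findSink, expand, trySink, tryArc, testSet,
    fill, WellFormed, ForProg.regs, h.wf, h.notMem_regs, this]

/-- The partition program computes a coloring with independent color classes and the minimum number
of colors. -/
theorem exists_exec_partition (h : IsIndepTest O N sz s₀ T) [N.Finite]
    (hN : ∀ x ∈ N.E, N.Indep {x}) (hk : s₀.var 2 = 0) (hcol : ∀ j, s₀.arr 2 j = 0) {n : ℕ}
    (h₀ : s₀.var 0 ≤ n) (h₁ : s₀.var 1 ≤ n) :
    ∃ t s, Exec O (partition sz T).compile s₀ t s ∧ t ≤ (partition sz T).cost.eval n ∧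
      (∀ c, N.Indep (colorClass N (s.arr 0) c)) ∧ NeedsColors N (s.arr 0 '' N.E).ncard := by
  obtain ⟨t, ht, hexec⟩ := exec_compile (O := O) h.partition_wellFormed s₀ h₀ h₁
  obtain ⟨k, hneed, hind, hmem⟩ := h.partition_run hN hk hcol
  refine ⟨t, _, hexec, ht, hind, fun g hg => le_trans ?_ (hneed g hg)⟩
  calc _ ≤ (Finset.Icc 1 k : Set ℕ).ncard := Set.ncard_le_ncard (by
        rintro _ ⟨j, hj, rfl⟩; exact hmem j hj) (Finset.finite_toSet _)
    _ = k := by rw [Set.ncard_coe_finset, Nat.card_Icc]; omega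

end IsIndepTest
end ForProg
end Courteous

namespace Courteous

/-! ## Courteous colorings of matroids -/

theorem Memory.storedSet_setArr_of_ne_zero (s : Memory) (a : ℕ) {i n v : ℕ} (hi : i < n)
    (hv : v ≠ 0) : (s.setArr a i v).storedSet a n = insert i (s.storedSet a n) := by
  ext j
  simp only [Memory.storedSet, Memory.setArr_arr_self, Set.mem_ofPred_eq, Set.mem_insert_iff]
  split_ifs with h <;> simp [h, hi, hv]

theorem Memory.storedSet_setArr_zero (s : Memory) (a i n : ℕ) :
    (s.setArr a i 0).storedSet a n = s.storedSet a n \ {i} := by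
  ext j
  simp only [Memory.storedSet, Memory.setArr_arr_self, Set.mem_ofPred_eq, Set.mem_sdiff,
    Set.mem_singleton_iff]
  split_ifs with h <;> simp [h]

theorem Memory.storedSet_congr {s s' : Memory} {a : ℕ} (h : s'.arr a = s.arr a) (n : ℕ) :
    s'.storedSet a n = s.storedSet a n := by
  simp only [Memory.storedSet, h]

@[simp] theorem Memory.storedSet_setVar (s : Memory) (x v a n : ℕ) :
    (s.setVar x v).storedSet a n = s.storedSet a n := rfl

namespace ForProg

/-- Extend the set in array `6` greedily to a basis of the complement of the set in array `5`. -/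
def greedyStep : ForProg :=
  .ite (.read 5 (.var 12)) .skip (.seq (.write 6 (.var 12) (.const 1)) (.seq (.query 13 6 0)
    (.ite (.var 13) .skip (.write 6 (.var 12) (.const 0)))))

/-- Check whether the set in array `6` can be extended by an element of the set in array `5`. -/
def extendStep : ForProg :=
  .ite (.read 5 (.var 12)) (.seq (.write 6 (.var 12) (.const 1)) (.seq (.query 13 6 0)
    (.seq (.ite (.var 13) (.assign 11 (.const 0)) .skip) (.write 6 (.var 12) (.const 0))))) .skip

/-- With an independence oracle, test whether the set in array `5` is coindependent. -/
def coindepTest : ForProg :=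
  .seq (fill 6 12 0 (.const 0)) (.seq (.forTo 12 0 greedyStep)
    (.seq (.assign 11 (.const 1)) (.forTo 12 0 extendStep)))

variable {O : Set ℕ → Prop} {L : Matroid ℕ}

theorem run_seq (p q : ForProg) (s : Memory) : (p.seq q).run O s = q.run O (p.run O s) := rfl

theorem run_ite_pos {e : Expr} {s : Memory} (h : e.eval s ≠ 0) (p q : ForProg) :
    (ForProg.ite e p q).run O s = p.run O s := by
  rw [run, if_pos h]

theorem run_ite_neg {e : Expr} {s : Memory} (h : e.eval s = 0) (p q : ForProg) :
    (ForProg.ite e p q).run O s = q.run O s := by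
  rw [run, if_neg (not_not.2 h)]

theorem run_query_of_pos {x a r : ℕ} {s : Memory} (h : O (s.storedSet a (s.var r))) :
    (query x a r).run O s = s.setVar x 1 := by
  rw [run, if_pos h]

theorem run_query_of_neg {x a r : ℕ} {s : Memory} (h : ¬ O (s.storedSet a (s.var r))) :
    (query x a r).run O s = s.setVar x 0 := by
  rw [run, if_neg h]

theorem run_write_seq_query (s : Memory) (p : ForProg) :
    ((write 6 (.var 12) (.const 1)).seq ((query 13 6 0).seq p)).run O s =
      p.run O ((query 13 6 0).run O (s.setArr 6 (s.var 12) 1)) := rfl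

/-- An element that cannot be added to an independent set is spanned by it, so rejecting it still
leaves a basis of the larger set. -/
theorem greedyStep_run {s : Memory} (hL : L.E = Set.Iio (s.var 0))
    (hO : ∀ X ⊆ L.E, O X ↔ L.Indep X) {Y : Set ℕ}
    (hB : L.IsBasis (s.storedSet 6 (s.var 0)) Y) (hlt : s.var 12 < s.var 0) :
    L.IsBasis ((greedyStep.run O s).storedSet 6 (s.var 0))
      (if s.arr 5 (s.var 12) = 0 then insert (s.var 12) Y else Y) := by
  have hmem : s.var 12 ∈ L.E := by rw [hL]; exact hlt
  by_cases hA : s.arr 5 (s.var 12) = 0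
  · rw [if_pos hA, greedyStep, run, if_neg (by simpa [Expr.eval] using hA)]
    rw [run_write_seq_query]
    have hset := s.storedSet_setArr_of_ne_zero 6 hlt one_ne_zero
    have hsub : insert (s.var 12) (s.storedSet 6 (s.var 0)) ⊆ L.E :=
      Set.insert_subset hmem hB.indep.subset_ground
    by_cases hI : L.Indep (insert (s.var 12) (s.storedSet 6 (s.var 0)))
    · have hq : O ((s.setArr 6 (s.var 12) 1).storedSet 6 (s.var 0)) := hset ▸ (hO _ hsub).2 hI
      rw [run_query_of_pos hq]
      rw [run_ite_pos (by simp [Expr.eval]), run, Memory.storedSet_setVar,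
        s.storedSet_setArr_of_ne_zero 6 hlt one_ne_zero]
      exact hB.insert_isBasis_insert hI
    · have hq : ¬ O ((s.setArr 6 (s.var 12) 1).storedSet 6 (s.var 0)) :=
        hset ▸ mt (hO _ hsub).1 hI
      rw [run_query_of_neg hq]
      rw [run_ite_neg (by simp [Expr.eval])]
      simp only [run, Expr.eval]
      -- Needed for undoing the tentative insertion: writing `0` must not remove an element that was
      -- there before.
      have h12 : s.var 12 ∉ s.storedSet 6 (s.var 0) := fun h => hI (by
        rw [Set.insert_eq_of_mem h]; exact hB.indep)
      rw [show (((s.setArr 6 (s.var 12) 1).setVar 13 0).var 12) = s.var 12 by simp,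
        Memory.storedSet_setArr_zero, Memory.storedSet_setVar,
        s.storedSet_setArr_of_ne_zero 6 hlt one_ne_zero,
        Set.insert_sdiff_self_of_notMem h12]
      refine hB.indep.isBasis_of_subset_of_subset_closure
        (hB.subset.trans (Set.subset_insert _ _)) (Set.insert_subset ?_ hB.subset_closure)
      rw [hB.indep.mem_closure_iff_of_notMem h12]
      exact ⟨hI, hsub⟩
  · rw [if_neg hA, greedyStep, run, if_pos (by simpa [Expr.eval] using hA)]
    exact hB

/-- The tested elements belong to the set in array `5`, which by `hB` is disjoint from the set in
array `6`; hence writing `0` after the test restores the latter. -/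
theorem extendStep_run {s : Memory} (hL : L.E = Set.Iio (s.var 0))
    (hO : ∀ X ⊆ L.E, O X ↔ L.Indep X) (hlt : s.var 12 < s.var 0)
    (hB : ∀ j ∈ s.storedSet 6 (s.var 0), s.arr 5 j = 0) :
    (extendStep.run O s).storedSet 6 (s.var 0) = s.storedSet 6 (s.var 0) ∧
      ((s.arr 5 (s.var 12) ≠ 0 ∧ L.Indep (insert (s.var 12) (s.storedSet 6 (s.var 0))) →
        (extendStep.run O s).var 11 = 0) ∧
      (¬ (s.arr 5 (s.var 12) ≠ 0 ∧ L.Indep (insert (s.var 12) (s.storedSet 6 (s.var 0)))) →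
        (extendStep.run O s).var 11 = s.var 11)) := by
  by_cases hA : s.arr 5 (s.var 12) = 0
  · rw [extendStep, run, if_neg (by simpa [Expr.eval] using hA)]
    simp [run, hA]
  · rw [extendStep, run, if_pos (by simpa [Expr.eval] using hA)]
    rw [run_write_seq_query]
    have hset := s.storedSet_setArr_of_ne_zero 6 hlt one_ne_zero
    have hsub : insert (s.var 12) (s.storedSet 6 (s.var 0)) ⊆ L.E := by
      rw [hL]
      exact Set.insert_subset hlt fun j hj => hj.1
    have h12 : s.var 12 ∉ s.storedSet 6 (s.var 0) := fun h => hA (hB _ h)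
    by_cases hI : L.Indep (insert (s.var 12) (s.storedSet 6 (s.var 0)))
    · have hq : O ((s.setArr 6 (s.var 12) 1).storedSet 6 (s.var 0)) := hset ▸ (hO _ hsub).2 hI
      rw [run_query_of_pos hq]
      rw [run_seq, run_ite_pos (by simp [Expr.eval])]
      simp only [run, Expr.eval]
      simp [hA, hI, Memory.storedSet_setArr_zero, s.storedSet_setArr_of_ne_zero 6 hlt,
        Set.insert_sdiff_self_of_notMem h12]
    · have hq : ¬ O ((s.setArr 6 (s.var 12) 1).storedSet 6 (s.var 0)) :=
        hset ▸ mt (hO _ hsub).1 hI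
      rw [run_query_of_neg hq]
      rw [run_seq, run_ite_neg (by simp [Expr.eval])]
      simp only [run, Expr.eval]
      simp [hI, Memory.storedSet_setArr_zero, s.storedSet_setArr_of_ne_zero 6 hlt,
        Set.insert_sdiff_self_of_notMem h12]

/-- `X` is coindependent iff `E \ X` is spanning, iff a basis `B` of `E \ X` cannot be extended.
Elements outside `X` are spanned by `B` anyway, so only those of `X` have to be tried. -/
theorem coindepTest_run {s : Memory} (hL : L.E = Set.Iio (s.var 0))
    (hO : ∀ X ⊆ L.E, O X ↔ L.Indep X) :
    (L✶.Indep (s.storedSet 5 (s.var 0)) → (coindepTest.run O s).var 11 = 1) ∧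
      (¬ L✶.Indep (s.storedSet 5 (s.var 0)) → (coindepTest.run O s).var 11 = 0) := by
  set n := s.var 0 with hn
  set s₁ := (fill 6 12 0 (.const 0)).run O s with hs₁
  have hag₁ : AgreeOff [12] [6] s s₁ := fill_agreeOff _ _ _ _ s
  have hs₁6 : s₁.storedSet 6 n = ∅ := by
    refine Set.eq_empty_of_forall_notMem fun j hj => hj.2 ?_
    exact run_fill (fun _ => 0) (fun _ _ _ => rfl) hj.1
  have hs₁0 : s₁.var 0 = n := hag₁.1 0 (by simp)
  have hs₁5 : s₁.arr 5 = s.arr 5 := hag₁.2 5 (by simp)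
  set s₂ := (ForProg.forTo 12 0 greedyStep).run O s₁ with hs₂
  have hkeep : ∀ s', AgreeOff (12 :: greedyStep.regs) greedyStep.arrs s₁ s' →
      s'.var 0 = n ∧ s'.arr 5 = s.arr 5 := fun s' hs' =>
    ⟨(hs'.1 0 (by simp [greedyStep, regs])).trans hs₁0,
      (hs'.2 5 (by simp [greedyStep, arrs])).trans hs₁5⟩
  have hbasis : L.IsBasis (s₂.storedSet 6 n) {j | j < n ∧ s.arr 5 j = 0} := by
    have := run_forTo (O := O) (i := 12) (r := 0) (p := greedyStep) (s := s₁)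
      (fun k s' => L.IsBasis (s'.storedSet 6 n) {j | j < k ∧ s.arr 5 j = 0}) ?_ ?_
    · rwa [hs₁0] at this
    · rw [Memory.storedSet_setVar, hs₁6]
      convert L.empty_indep.isBasis_self
      simp
    · intro k hk s' hs'12 hs' ih
      obtain ⟨h0, h5⟩ := hkeep s' hs'
      have := greedyStep_run (O := O) (s := s') (by rwa [h0]) hO (by rwa [h0])
        (by rw [hs'12, h0, ← hs₁0]; exact hk)
      rw [h0, h5, hs'12] at this
      rw [Memory.storedSet_setVar]
      convert this using 1
      ext j
      simp only [Set.mem_ofPred_eq, Nat.lt_succ_iff_lt_or_eq]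
      split_ifs <;> grind
  obtain ⟨hs₂0, hs₂5⟩ := hkeep s₂ (run_agreeOff (.forTo 12 0 greedyStep) s₁)
  set B := s₂.storedSet 6 n with hB
  have hfin := run_forTo (O := O) (i := 12) (r := 0) (p := extendStep) (s := s₂.setVar 11 1)
    (fun k s' => s'.storedSet 6 n = B ∧
      (s'.var 11 = 0 ∧ (∃ j < k, s.arr 5 j ≠ 0 ∧ L.Indep (insert j B)) ∨
        s'.var 11 = 1 ∧ ∀ j < k, s.arr 5 j ≠ 0 → ¬ L.Indep (insert j B))) ?_ ?_
  · have hrun : coindepTest.run O s = (ForProg.forTo 12 0 extendStep).run O (s₂.setVar 11 1) :=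
      rfl
    rw [hrun]
    have hsub : s.storedSet 5 n ⊆ L.E := by
      rw [hL]
      exact fun j hj => hj.1
    have hcompl : L.E \ s.storedSet 5 n = {j | j < n ∧ s.arr 5 j = 0} := by
      ext j
      simp only [hL, Memory.storedSet, Set.mem_sdiff, Set.mem_Iio, Set.mem_ofPred_eq]
      grind
    have hiff : L✶.Indep (s.storedSet 5 n) ↔ ∀ j < n, s.arr 5 j ≠ 0 → ¬ L.Indep (insert j B) := by
      rw [← Matroid.coindep_def, Matroid.coindep_iff_compl_spanning, hcompl,
        ← hbasis.spanning_iff_spanning,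
        Matroid.spanning_iff_ground_subset_closure hbasis.indep.subset_ground]
      constructor
      · intro hsp j hj hj5 hI
        have hjB : j ∉ B := fun h => hj5 (hbasis.subset h).2
        have hj' : j ∈ L.E := by rw [hL]; exact hj
        exact ((hbasis.indep.mem_closure_iff_of_notMem hjB).1 (hsp hj')).not_indep hI
      · intro hno j hj
        have hjn : j < n := by rw [hL] at hj; exact hj
        by_cases hj5 : s.arr 5 j = 0
        · exact hbasis.subset_closure ⟨hjn, hj5⟩
        · have hjB : j ∉ B := fun h => hj5 (hbasis.subset h).2
          rw [hbasis.indep.mem_closure_iff_of_notMem hjB]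
          exact ⟨hno j hjn hj5, Set.insert_subset hj hbasis.indep.subset_ground⟩
    rw [hiff]
    have h0 : (s₂.setVar 11 1).var 0 = n := by simpa using hs₂0
    rw [h0] at hfin
    rcases hfin.2 with ⟨h₁, j, hj, hj5, hI⟩ | ⟨h₁, h₂⟩
    · exact ⟨fun h => absurd hI (h j hj hj5), fun _ => h₁⟩
    · exact ⟨fun _ => h₁, fun h => absurd h₂ h⟩
  · exact ⟨rfl, Or.inr ⟨by simp, fun j hj => absurd hj (by omega)⟩⟩
  rintro k hk s' hs'12 hs' ⟨ih₁, ih₂⟩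
  have h0 : s'.var 0 = n := by
    rw [hs'.1 0 (by simp [extendStep, regs])]; simpa using hs₂0
  have h5 : s'.arr 5 = s.arr 5 := by
    rw [hs'.2 5 (by simp [extendStep, arrs])]; simpa using hs₂5
  have hkn : k < n := by simpa [hs₂0] using hk
  have hstep := extendStep_run (O := O) (s := s') (by rwa [h0]) hO (by rwa [h0, hs'12])
    (by rw [h0, h5, ih₁]; exact fun j hj => (hbasis.subset hj).2)
  rw [h0, h5, hs'12, ih₁] at hstep
  refine ⟨by simpa using hstep.1, ?_⟩
  rw [show ((extendStep.run O s').setVar 12 (k + 1)).var 11 = (extendStep.run O s').var 11 by simp]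
  by_cases hP : s.arr 5 k ≠ 0 ∧ L.Indep (insert k B)
  · exact Or.inl ⟨hstep.2.1 hP, k, by omega, hP⟩
  · rw [hstep.2.2 hP]
    refine ih₂.imp (fun ⟨h₁, j, hj, h₂⟩ => ⟨h₁, j, by omega, h₂⟩) fun ⟨h₁, h₂⟩ => ⟨h₁, ?_⟩
    intro j hj hj5 hI
    rcases Nat.lt_succ_iff_lt_or_eq.1 hj with hj | rfl
    · exact h₂ j hj hj5 hI
    · exact hP ⟨hj5, hI⟩

theorem isIndepTest_coindepTest {s₀ : Memory} (hL : L.E = Set.Iio (s₀.var 0))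
    (hO : ∀ X ⊆ L.E, O X ↔ L.Indep X) : IsIndepTest O L✶ 0 s₀ coindepTest where
  wf := by simp [coindepTest, greedyStep, extendStep, fill, WellFormed, regs]
  regs := by simp [coindepTest, greedyStep, extendStep, fill, regs]
  arrs := by simp [coindepTest, greedyStep, extendStep, fill, arrs]
  sz_lt := by omega
  mem_ground := by simp [hL]
  test s hs _ := coindepTest_run (by rw [hL, hs 0 (by omega)]) hO

end ForProg

/-- Deletion of `X` keeps the rank iff the complement of `X` has full rank; in a finite matroid this
means that it is spanning, so that `X` is coindependent. -/
theorem isCourteous_one_iff {α C : Type*} {M : Matroid α} [M.Finite] {f : M.E → C} :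
    IsCourteous M 1 f ↔ ∀ c, M✶.Indep (Subtype.val '' (f ⁻¹' {c})) := by
  have key : ∀ X ⊆ M.E, (M.delete X).eRank = M.eRank ↔ M✶.Indep X := by
    intro X hX
    rw [← Matroid.coindep_def, Matroid.coindep_iff_compl_spanning, Matroid.spanning_iff_eRk_le,
      Matroid.delete_eq_restrict, Matroid.eRank_restrict]
    exact ⟨fun h => h.ge, fun h => le_antisymm (M.eRk_le_eRank _) h⟩
  have hsub : ∀ s : Set M.E, Subtype.val '' s ⊆ M.E := fun s => by
    rintro _ ⟨x, -, rfl⟩; exact x.2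
  constructor
  · intro h c
    rw [← key _ (hsub _)]
    simpa using h {c} (by simp)
  · intro h D hD
    rw [key _ (hsub _)]
    rcases D.eq_empty_or_nonempty with rfl | ⟨c, hc⟩
    · simp
    · refine (h c).subset (Set.image_mono (Set.preimage_mono fun d hd => ?_))
      exact Finset.card_le_one.1 hD d hd c hc

/-- The common last step for matroids and graphs: it carries optimality from colorings of numbers
back to colorings of the labelled elements. -/
theorem minimal_of_needsColors {E : Type*} {N : Matroid ℕ} {n : ℕ} (hN : N.E = Set.Iio n)
    (lab : Fin n ≃ E) {Good : (E → ℕ) → Prop}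
    (hGood : ∀ f, Good f ↔ ∀ c, N.Indep {i | ∃ h : i < n, f (lab ⟨i, h⟩) = c}) {col : ℕ → ℕ}
    (hcol : ∀ c, N.Indep (colorClass N col c)) (hneed : NeedsColors N (col '' N.E).ncard) :
    Good (fun x => col (lab.symm x)) ∧ ∀ g, Good g →
      (Set.range fun x => col (lab.symm x)).ncard ≤ (Set.range g).ncard := by
  refine ⟨?_, fun g hg => ?_⟩
  · rw [hGood]
    intro c
    convert hcol c using 1
    ext i
    simp [colorClass, hN]
  -- The default value `0` is harmless, because classes and counted colors are restricted to the
  -- ground set.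
  · set g' : ℕ → ℕ := fun i => if h : i < n then g (lab ⟨i, h⟩) else 0 with hg'
    have hcls : ∀ c, colorClass N g' c = {i | ∃ h : i < n, g (lab ⟨i, h⟩) = c} := by
      intro c
      ext i
      by_cases hi : i < n <;> simp [colorClass, hN, hg', hi]
    have h := hneed g' fun c => by rw [hcls]; exact (hGood g).1 hg c
    have h₁ : (Set.range fun x => col (lab.symm x)) = col '' N.E := by
      ext c
      simp only [Set.mem_range, Set.mem_image, hN, Set.mem_Iio]
      exact ⟨fun ⟨x, hx⟩ => ⟨_, (lab.symm x).2, hx⟩,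
        fun ⟨i, hi, hx⟩ => ⟨lab ⟨i, hi⟩, by simpa using hx⟩⟩
    have h₂ : g' '' N.E = Set.range g := by
      ext c
      simp only [Set.mem_range, Set.mem_image, hN, Set.mem_Iio]
      refine ⟨fun ⟨i, hi, hx⟩ => ⟨lab ⟨i, hi⟩, by simpa [hg', hi] using hx⟩, fun ⟨x, hx⟩ => ?_⟩
      exact ⟨_, (lab.symm x).2, by simpa [hg'] using hx⟩
    rwa [h₁, ← h₂]

/-! ### Copying a matroid onto the numbers below `n` -/

open Classical in
/-- The label of an element of `E`. -/
noncomputable def label {α : Type*} {E : Set α} {n : ℕ} (lab : Fin n ≃ E) (x : α) : ℕ :=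
  if h : x ∈ E then lab.symm ⟨x, h⟩ else 0

section Label

variable {α : Type*} {E : Set α} {n : ℕ} {lab : Fin n ≃ E}

@[simp] theorem label_apply (i : Fin n) : label lab (lab i) = i := by
  simp [label]

theorem exists_eq_of_mem {x : α} (hx : x ∈ E) : ∃ i, (lab i : α) = x :=
  ⟨lab.symm ⟨x, hx⟩, by simp⟩

theorem injOn_label (lab : Fin n ≃ E) : Set.InjOn (label lab) E := by
  intro x hx y hy hxy
  obtain ⟨i, rfl⟩ := exists_eq_of_mem (lab := lab) hx
  obtain ⟨j, rfl⟩ := exists_eq_of_mem (lab := lab) hy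
  rw [label_apply, label_apply] at hxy
  rw [Fin.ext hxy]

theorem image_label : label lab '' E = Set.Iio n := by
  ext i
  constructor
  · rintro ⟨x, hx, rfl⟩
    obtain ⟨j, rfl⟩ := exists_eq_of_mem (lab := lab) hx
    simp
  · exact fun hi => ⟨lab ⟨i, hi⟩, Subtype.coe_prop _, label_apply _⟩

/-- The right-hand side is the answer of `indepOracle`, so the oracle of `M` also serves the copy of
`M` on the numbers. -/
theorem map_label_indep_iff {M : Matroid α} {lab : Fin n ≃ M.E} {X : Set ℕ}
    (hX : X ⊆ Set.Iio n) : (M.map (label lab) (injOn_label lab)).Indep X ↔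
      M.Indep {x | ∃ i : Fin n, (i : ℕ) ∈ X ∧ (lab i : α) = x} := by
  have himage : label lab '' {x | ∃ i : Fin n, (i : ℕ) ∈ X ∧ (lab i : α) = x} = X := by
    ext i
    constructor
    · rintro ⟨_, ⟨j, hj, rfl⟩, rfl⟩
      rwa [label_apply]
    · exact fun hi => ⟨_, ⟨⟨i, hX hi⟩, hi, rfl⟩, label_apply _⟩
  rw [Matroid.map_indep_iff]
  constructor
  · rintro ⟨I, hI, rfl⟩
    refine hI.subset ?_
    rintro _ ⟨i, ⟨x, hx, hxi⟩, rfl⟩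
    obtain ⟨j, rfl⟩ := exists_eq_of_mem (lab := lab) (hI.subset_ground hx)
    rw [label_apply] at hxi
    rwa [← Fin.ext hxi]
  · exact fun h => ⟨_, h, himage.symm⟩

end Label

theorem exists_exec_isMinCourteous {α : Type*} {M : Matroid α} {n : ℕ} (lab : Fin n ≃ M.E)
    (hM : Bridgeless M) :
    ∃ t s, Exec (indepOracle M lab) (ForProg.partition 0 ForProg.coindepTest).compile
      (matroidInput n) t s ∧ t ≤ (ForProg.partition 0 ForProg.coindepTest).cost.eval n ∧
      IsMinCourteous M 1 (fun x => s.arr 0 (lab.symm x)) := by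
  have : Finite M.E := Finite.of_equiv _ lab
  have hfin : M.Finite := ⟨Set.toFinite _⟩
  set L := M.map (label lab) (injOn_label lab) with hL
  have hLE : L.E = Set.Iio n := image_label
  have hLfin : L.Finite := ⟨hLE ▸ Set.finite_Iio n⟩
  have hdual : ∀ X ⊆ Set.Iio n, L✶.Indep X ↔
      M✶.Indep {x | ∃ i : Fin n, (i : ℕ) ∈ X ∧ (lab i : α) = x} := by
    intro X hX
    rw [hL, Matroid.map_dual]
    exact map_label_indep_iff (M := M✶) hX
  have htest : ForProg.IsIndepTest (indepOracle M lab) L✶ 0 (matroidInput n)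
      ForProg.coindepTest :=
    ForProg.isIndepTest_coindepTest (by simpa [matroidInput] using hLE)
      fun X hX => (map_label_indep_iff (hLE ▸ hX)).symm
  -- A loop of the dual is a circuit of size one, which bridgelessness excludes.
  have hloop : ∀ i ∈ L✶.E, L✶.Indep {i} := by
    intro i hi
    have hi' : i < n := by rw [Matroid.dual_ground, hLE] at hi; exact hi
    rw [hdual _ (by simpa using hi')]
    have : {x | ∃ j : Fin n, (j : ℕ) ∈ ({i} : Set ℕ) ∧ (lab j : α) = x} =
        {(lab ⟨i, hi'⟩ : α)} := by
      ext x
      constructor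
      · rintro ⟨j, hj, rfl⟩
        have : j = ⟨i, hi'⟩ := Fin.ext hj
        rw [this]
        rfl
      · rintro rfl
        exact ⟨_, Set.mem_singleton i, rfl⟩
    rw [this]
    by_contra hdep
    refine hM (lab ⟨i, hi'⟩) ?_
    rw [Matroid.singleton_isCircuit, Matroid.singleton_not_indep] at *
    exact hdep
  obtain ⟨t, s, hexec, ht, hind, hneed⟩ := htest.exists_exec_partition hloop
    (by simp [matroidInput]) (by simp [matroidInput]) (n := n) (by simp [matroidInput])
    (by simp [matroidInput])
  refine ⟨t, s, hexec, ht, minimal_of_needsColors (N := L✶) hLE lab (fun f => ?_) hind hneed⟩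
  rw [isCourteous_one_iff]
  refine forall_congr' fun c => ?_
  rw [hdual _ (by rintro i ⟨hi, -⟩; exact hi)]
  convert Iff.rfl using 2
  ext x
  constructor
  · rintro ⟨i, ⟨hi, hc⟩, rfl⟩
    exact ⟨lab i, hc, rfl⟩
  · rintro ⟨y, hy, rfl⟩
    exact ⟨lab.symm y, ⟨(lab.symm y).2, by simpa using hy⟩, by simp⟩

end Courteous

namespace Courteous

/-! ## The matroid of a finite family of vectors -/

section VectorMatroid

variable {ι K W : Type*} [Field K] [AddCommGroup W] [Module K W]

theorem finrank_span_image_of_linearIndepOn {v : ι → W} {I : Set ι} (hI : I.Finite)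
    (h : LinearIndepOn K v I) : Module.finrank K (Submodule.span K (v '' I)) = I.ncard := by
  have := hI.fintype
  rw [Set.image_eq_range, finrank_span_eq_card h, ← Nat.card_eq_fintype_card, Nat.card_coe_set_eq]

/-- The matroid of linear independence on a finite family of vectors. -/
noncomputable def vectorMatroid (K : Type*) [Field K] [Module K W] (v : ι → W) {E : Set ι}
    (hE : E.Finite) : Matroid ι :=
  (IndepMatroid.ofFinite hE (fun I => I ⊆ E ∧ LinearIndepOn K v I)
    ⟨Set.empty_subset E, linearIndepOn_empty K v⟩
    (fun _ _ hJ hIJ => ⟨hIJ.trans hJ.1, hJ.2.mono hIJ⟩)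
    (by
      rintro I J ⟨hIE, hI⟩ ⟨hJE, hJ⟩ hlt
      by_contra! hno
      -- If no element of `J` extends `I`, all of `J` lies in the span of `I`, which contradicts
      -- `|I| < |J|` by dimension.
      have hspan : Submodule.span K (v '' J) ≤ Submodule.span K (v '' I) := by
        rw [Submodule.span_le]
        rintro _ ⟨e, he, rfl⟩
        by_cases heI : e ∈ I
        · exact Submodule.subset_span ⟨e, heI, rfl⟩
        · by_contra hev
          exact hno e he heI (Set.insert_subset (hJE he) hIE)
            ((linearIndepOn_insert heI).2 ⟨hI, hev⟩)
      have : FiniteDimensional K (Submodule.span K (v '' I)) :=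
        FiniteDimensional.span_of_finite K ((hE.subset hIE).image v)
      have := Submodule.finrank_mono hspan
      rw [finrank_span_image_of_linearIndepOn (hE.subset hIE) hI,
        finrank_span_image_of_linearIndepOn (hE.subset hJE) hJ] at this
      omega)
    (fun _ hI => hI.1)).matroid

variable {v : ι → W} {E : Set ι} {hE : E.Finite}

@[simp] theorem vectorMatroid_ground : (vectorMatroid K v hE).E = E := rfl

theorem vectorMatroid_indep_iff {I : Set ι} :
    (vectorMatroid K v hE).Indep I ↔ I ⊆ E ∧ LinearIndepOn K v I := by
  simp [vectorMatroid]

theorem vectorMatroid_mem_closure_iff {I : Set ι} (hI : (vectorMatroid K v hE).Indep I) {e : ι}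
    (he : e ∈ E) : e ∈ (vectorMatroid K v hE).closure I ↔ v e ∈ Submodule.span K (v '' I) := by
  by_cases heI : e ∈ I
  · exact iff_of_true (Matroid.mem_closure_of_mem' _ heI he) (Submodule.subset_span ⟨e, heI, rfl⟩)
  · have hI' := vectorMatroid_indep_iff.1 hI
    have hsub : insert e I ⊆ E := Set.insert_subset he hI'.1
    rw [hI.mem_closure_iff_of_notMem heI, Matroid.Dep, vectorMatroid_indep_iff,
      linearIndepOn_insert heI]
    simp [hsub, hI'.2]

theorem vectorMatroid_spanning_iff {X : Set ι} (hX : X ⊆ E) :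
    (vectorMatroid K v hE).Spanning X ↔ ∀ e ∈ E, v e ∈ Submodule.span K (v '' X) := by
  obtain ⟨B, hB⟩ := (vectorMatroid K v hE).exists_isBasis X hX
  have hspan : Submodule.span K (v '' B) = Submodule.span K (v '' X) := by
    refine le_antisymm (Submodule.span_mono (Set.image_mono hB.subset)) (Submodule.span_le.2 ?_)
    rintro _ ⟨e, he, rfl⟩
    exact (vectorMatroid_mem_closure_iff hB.indep (hX he)).1 (hB.subset_closure he)
  rw [← hB.spanning_iff_spanning, ← hspan,
    Matroid.spanning_iff_ground_subset_closure hB.indep.subset_ground]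
  exact forall₂_congr fun e he => vectorMatroid_mem_closure_iff hB.indep he

end VectorMatroid

/-! ## Connectivity of numbered graphs -/

section Numbered

variable {n m : ℕ} (end₀ end₁ : Fin m → Fin n)

/-- No edge outside `X` leaves `S`. -/
def EdgeClosed (X : Set ℕ) (S : Set (Fin n)) : Prop :=
  ∀ i : Fin m, (i : ℕ) ∉ X → (end₀ i ∈ S ↔ end₁ i ∈ S)

/-- The graph with the given ends of edges is connected after the removal of the edges in `X`. -/
def ConnectedOff (X : Set ℕ) : Prop :=
  ∀ S : Set (Fin n), S.Nonempty → EdgeClosed end₀ end₁ X S → S = Set.univ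

/-- The difference of the ends of an edge. -/
def edgeVector (i : ℕ) : Fin n → ℚ :=
  if h : i < m then Pi.single (end₀ ⟨i, h⟩) 1 - Pi.single (end₁ ⟨i, h⟩) 1 else 0

/-- The cycle matroid of a numbered graph. -/
noncomputable def cycleMatroid : Matroid ℕ :=
  vectorMatroid ℚ (edgeVector end₀ end₁) (Set.finite_Iio m)

variable {end₀ end₁}

@[simp] theorem edgeVector_coe (i : Fin m) :
    edgeVector end₀ end₁ i = Pi.single (end₀ i) 1 - Pi.single (end₁ i) 1 := by
  simp [edgeVector]

theorem ConnectedOff.anti {X Y : Set ℕ} (h : ConnectedOff end₀ end₁ Y) (hXY : X ⊆ Y) :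
    ConnectedOff end₀ end₁ X :=
  fun S hS hcl => h S hS fun i hi => hcl i fun hi' => hi (hXY hi')

theorem EdgeClosed.compl {X : Set ℕ} {S : Set (Fin n)} (h : EdgeClosed end₀ end₁ X S) :
    EdgeClosed end₀ end₁ X Sᶜ :=
  fun i hi => not_congr (h i hi)

/-- The vertices `c` for which the difference of the unit vectors at `a` and `c` is in the span form
a set containing `a` that no remaining edge leaves. -/
theorem ConnectedOff.single_sub_single_mem_span {X : Set ℕ} (h : ConnectedOff end₀ end₁ X)
    (a b : Fin n) : (Pi.single a 1 - Pi.single b 1 : Fin n → ℚ) ∈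
      Submodule.span ℚ (edgeVector end₀ end₁ '' (Set.Iio m \ X)) := by
  set P := Submodule.span ℚ (edgeVector end₀ end₁ '' (Set.Iio m \ X))
  have huniv := h {c | (Pi.single a 1 - Pi.single c 1 : Fin n → ℚ) ∈ P}
    ⟨a, by simp⟩ fun i hi => ?_
  · exact (Set.eq_univ_iff_forall.1 huniv) b
  have hi' : (Pi.single (end₀ i) 1 - Pi.single (end₁ i) 1 : Fin n → ℚ) ∈ P :=
    Submodule.subset_span ⟨i, ⟨i.2, hi⟩, edgeVector_coe i⟩
  simp only [Set.mem_ofPred_eq]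
  constructor
  · intro h₀
    simpa using P.add_mem h₀ hi'
  · intro h₁
    simpa using P.sub_mem h₁ hi'

/-- Spanning in the cycle matroid only means that deletion creates no new components; `hconn` turns
this into connectedness. -/
theorem cycleMatroid_dual_indep_iff (hconn : ConnectedOff end₀ end₁ ∅) {X : Set ℕ}
    (hX : X ⊆ Set.Iio m) : (cycleMatroid end₀ end₁)✶.Indep X ↔ ConnectedOff end₀ end₁ X := by
  rw [← Matroid.coindep_def, Matroid.coindep_iff_compl_spanning (by exact hX)]
  refine (vectorMatroid_spanning_iff (K := ℚ) (hE := Set.finite_Iio m)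
    (X := Set.Iio m \ X) Set.sdiff_subset).trans ?_
  constructor
  · intro hspan S ⟨a, ha⟩ hS
    refine Set.eq_univ_of_forall fun b => ?_
    by_contra hb
    classical
    -- The sum of the coordinates in `S` vanishes on every edge that does not leave `S`, hence on
    -- all remaining edges and on their span, but it is `1` on the difference of the unit vectors at
    -- `a ∈ S` and `b ∉ S`.
    set φ : (Fin n → ℚ) →ₗ[ℚ] ℚ := ∑ c ∈ S.toFinset, LinearMap.proj c with hφ
    have hsingle : ∀ c, φ (Pi.single c 1) = if c ∈ S then 1 else 0 := by
      intro c
      simp [hφ, LinearMap.sum_apply, Pi.single_apply]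
    have hker : Submodule.span ℚ (edgeVector end₀ end₁ '' (Set.Iio m \ X)) ≤ LinearMap.ker φ := by
      rw [Submodule.span_le]
      rintro _ ⟨i, ⟨hi, hiX⟩, rfl⟩
      have := hS ⟨i, hi⟩ hiX
      rw [SetLike.mem_coe, LinearMap.mem_ker, edgeVector, dif_pos (Set.mem_Iio.1 hi), map_sub,
        hsingle, hsingle]
      simp [this]
    have hall : Submodule.span ℚ (edgeVector end₀ end₁ '' (Set.Iio m \ ∅)) ≤
        LinearMap.ker φ := by
      refine le_trans (Submodule.span_le.2 ?_) hker
      rintro _ ⟨i, hi, rfl⟩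
      exact hspan i hi.1
    have := hall (hconn.single_sub_single_mem_span a b)
    rw [LinearMap.mem_ker, map_sub, hsingle, hsingle, if_pos ha, if_neg hb] at this
    norm_num at this
  · intro h i hi
    rw [edgeVector, dif_pos (Set.mem_Iio.1 hi)]
    exact h.single_sub_single_mem_span _ _

end Numbered

/-! ## A connectivity test -/

namespace ForProg

/-- If one end of the edge in register `13` has been reached, mark the other end. -/
def floodStep : ForProg :=
  .ite (.read 5 (.var 13)) .skip
    (.ite (.add (.read 6 (.read 0 (.var 13))) (.read 6 (.read 1 (.var 13))))
      (.seq (.write 6 (.read 0 (.var 13)) (.const 1)) (.write 6 (.read 1 (.var 13)) (.const 1)))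
      .skip)

/-- Test whether the graph is connected after the removal of the edges in array `5`. -/
def connectedTest : ForProg :=
  .seq (fill 6 12 0 (.eq (.var 12) (.const 0))) (.seq (.forTo 12 0 (.forTo 13 1 floodStep))
    (.seq (.assign 11 (.const 1)) (.forTo 12 0 (.ite (.read 6 (.var 12)) .skip
      (.assign 11 (.const 0))))))

/-- The vertices marked in array `6`. -/
def reached (n : ℕ) (s : Memory) : Set (Fin n) := {a | s.arr 6 a ≠ 0}

variable {O : Set ℕ → Prop} {n m : ℕ} {end₀ end₁ : Fin m → Fin n}

theorem floodStep_run {s : Memory} (j : Fin m) (hj : s.var 13 = j) (h₀ : s.arr 0 j = end₀ j)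
    (h₁ : s.arr 1 j = end₁ j) :
    reached n (floodStep.run O s) = reached n s ∪
      {a | s.arr 5 j = 0 ∧ (end₀ j ∈ reached n s ∨ end₁ j ∈ reached n s) ∧
        (a = end₀ j ∨ a = end₁ j)} := by
  by_cases h5 : s.arr 5 j = 0
  · rw [floodStep, run, if_neg (by simp [Expr.eval, hj, h5]), run]
    by_cases hr : end₀ j ∈ reached n s ∨ end₁ j ∈ reached n s
    · rw [if_pos]
      · ext a
        simp only [reached, run, Expr.eval, Set.mem_ofPred_eq, Set.mem_union, h5, true_and,
          Memory.setArr_arr_self, Memory.setArr_var, hj, h₀,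
          Memory.setArr_arr_of_ne _ _ _ _ (show (1 : ℕ) ≠ 6 by omega), h₁, Fin.val_inj]
        have hr' : s.arr 6 (end₀ j) ≠ 0 ∨ s.arr 6 (end₁ j) ≠ 0 := hr
        split_ifs <;> simp_all
      · have hr' : s.arr 6 (end₀ j) ≠ 0 ∨ s.arr 6 (end₁ j) ≠ 0 := hr
        simp only [Expr.eval, hj, h₀, h₁]
        omega
    · rw [if_neg]
      · simp [run, hr]
      · have hr' : ¬ (s.arr 6 (end₀ j) ≠ 0 ∨ s.arr 6 (end₁ j) ≠ 0) := hr
        simp only [Expr.eval, hj, h₀, h₁]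
        omega
  · rw [floodStep, run, if_pos (by simpa [Expr.eval, hj] using h5), run]
    simp [h5]

/-- One pass over the edges never leaves a closed set containing the start, and a pass that marks
nothing new proves that the marked set is closed. -/
theorem flood_run {s : Memory} (hm : s.var 1 = m) (h₀ : ∀ j : Fin m, s.arr 0 j = end₀ j)
    (h₁ : ∀ j : Fin m, s.arr 1 j = end₁ j) {s' : Memory}
    (hs' : (ForProg.forTo 13 1 floodStep).run O s = s') :
    reached n s ⊆ reached n s' ∧
    (∀ S, EdgeClosed end₀ end₁ (s.storedSet 5 m) S → reached n s ⊆ S → reached n s' ⊆ S) ∧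
    (reached n s' = reached n s → EdgeClosed end₀ end₁ (s.storedSet 5 m) (reached n s)) := by
  subst hs'
  have hX : ∀ j : Fin m, (j : ℕ) ∉ s.storedSet 5 m ↔ s.arr 5 j = 0 := by
    intro j
    simp [Memory.storedSet]
  have := run_forTo (O := O) (i := 13) (r := 1) (p := floodStep) (s := s)
    (fun k s' => reached n s ⊆ reached n s' ∧
      (∀ S, EdgeClosed end₀ end₁ (s.storedSet 5 m) S → reached n s ⊆ S → reached n s' ⊆ S) ∧
      (reached n s' = reached n s → ∀ j : Fin m, (j : ℕ) < k → (j : ℕ) ∉ s.storedSet 5 m →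
        (end₀ j ∈ reached n s ↔ end₁ j ∈ reached n s))) ?_ ?_
  · rw [hm] at this
    exact ⟨this.1, this.2.1, fun h j hj => this.2.2 h j j.2 hj⟩
  · exact ⟨subset_rfl, fun S _ h => h, fun _ j hj => absurd hj (by omega)⟩
  rintro k hk s' hs'13 hs' ⟨ih₁, ih₂, ih₃⟩
  rw [hm] at hk
  have h5' : s'.arr 5 = s.arr 5 := hs'.2 5 (by simp [floodStep, arrs])
  have hrun := floodStep_run (O := O) (s := s') (end₀ := end₀) (end₁ := end₁) ⟨k, hk⟩ hs'13
    (by rw [hs'.2 0 (by simp [floodStep, arrs]), h₀])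
    (by rw [hs'.2 1 (by simp [floodStep, arrs]), h₁])
  rw [h5', ← hX] at hrun
  have hset : reached n ((floodStep.run O s').setVar 13 (k + 1)) = reached n (floodStep.run O s') :=
    rfl
  rw [hset, hrun]
  refine ⟨ih₁.trans Set.subset_union_left, fun S hS hsub => ?_, fun heq j hj hjX => ?_⟩
  · refine Set.union_subset (ih₂ S hS hsub) ?_
    rintro a ⟨hkX, hr, ha⟩
    have hr' := hr.imp (fun h => ih₂ S hS hsub h) (fun h => ih₂ S hS hsub h)
    have := hS _ hkX
    rcases ha with rfl | rfl <;> tauto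
  · have hs's : reached n s' = reached n s :=
      subset_antisymm (Set.subset_union_left.trans heq.subset) ih₁
    rcases Nat.lt_succ_iff_lt_or_eq.1 hj with hj | hj
    · exact ih₃ hs's j hj hjX
    · obtain rfl : j = ⟨k, hk⟩ := Fin.ext hj
      rw [hs's] at heq
      constructor
      · exact fun h => heq.subset (Or.inr ⟨hjX, Or.inl h, Or.inr rfl⟩)
      · exact fun h => heq.subset (Or.inr ⟨hjX, Or.inr h, Or.inl rfl⟩)

/-- The flood from vertex `0` ends with the smallest closed set containing it. The graph is
connected iff this set is everything, since complements of closed sets are closed. -/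
theorem connectedTest_run {s : Memory} (hn : s.var 0 = n) (hpos : 0 < n) (hm : s.var 1 = m)
    (h₀ : ∀ j : Fin m, s.arr 0 j = end₀ j) (h₁ : ∀ j : Fin m, s.arr 1 j = end₁ j) :
    (ConnectedOff end₀ end₁ (s.storedSet 5 m) → (connectedTest.run O s).var 11 = 1) ∧
      (¬ ConnectedOff end₀ end₁ (s.storedSet 5 m) → (connectedTest.run O s).var 11 = 0) := by
  set X := s.storedSet 5 m with hX
  set o : Fin n := ⟨0, hpos⟩
  set s₁ := (fill 6 12 0 (.eq (.var 12) (.const 0))).run O s with hs₁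
  have hag₁ : AgreeOff [12] [6] s s₁ := fill_agreeOff _ _ _ _ s
  have hs₁6 : reached n s₁ = {o} := by
    ext a
    have : s₁.arr 6 a = if (a : ℕ) = 0 then 1 else 0 :=
      run_fill (fun j => if j = 0 then 1 else 0) (fun s' _ _ => by simp only [Expr.eval]; congr)
        (by rw [hn]; exact a.2)
    simp [reached, this, o, Fin.ext_iff]
  set p : ForProg := .forTo 13 1 floodStep with hp
  have hkeep : ∀ s', AgreeOff (12 :: p.regs) p.arrs s₁ s' → s'.var 0 = n ∧ s'.var 1 = m ∧
      s'.arr 0 = s.arr 0 ∧ s'.arr 1 = s.arr 1 ∧ s'.arr 5 = s.arr 5 := by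
    intro s' hs'
    refine ⟨?_, ?_, ?_, ?_, ?_⟩
    · rw [hs'.1 0 (by simp [hp, floodStep, regs]), hag₁.1 0 (by simp), hn]
    · rw [hs'.1 1 (by simp [hp, floodStep, regs]), hag₁.1 1 (by simp), hm]
    · rw [hs'.2 0 (by simp [hp, floodStep, arrs]), hag₁.2 0 (by simp)]
    · rw [hs'.2 1 (by simp [hp, floodStep, arrs]), hag₁.2 1 (by simp)]
    · rw [hs'.2 5 (by simp [hp, floodStep, arrs]), hag₁.2 5 (by simp)]
  set s₂ := (ForProg.forTo 12 0 p).run O s₁ with hs₂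
  have hs₁0 : s₁.var 0 = n := by rw [hag₁.1 0 (by simp), hn]
  -- A pass that changes the marked set adds a vertex. If the set were not closed after `n` passes,
  -- it would have `n + 1` elements among `n` vertices.
  obtain ⟨ho, hmin, hcl⟩ : o ∈ reached n s₂ ∧
      (∀ S, EdgeClosed end₀ end₁ X S → o ∈ S → reached n s₂ ⊆ S) ∧
      (EdgeClosed end₀ end₁ X (reached n s₂) ∨ n + 1 ≤ (reached n s₂).ncard) := by
    have := run_forTo (O := O) (i := 12) (r := 0) (p := p) (s := s₁)
      (fun t s' => o ∈ reached n s' ∧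
        (∀ S, EdgeClosed end₀ end₁ X S → o ∈ S → reached n s' ⊆ S) ∧
        (EdgeClosed end₀ end₁ X (reached n s') ∨ t + 1 ≤ (reached n s').ncard)) ?_ ?_
    · rwa [hs₁0] at this
    · have : reached n (s₁.setVar 12 0) = {o} := hs₁6
      rw [this]
      exact ⟨rfl, fun S _ h => by simpa using h, Or.inr (by simp)⟩
    rintro t ht s' - hs' ⟨ih₁, ih₂, ih₃⟩
    obtain ⟨q₀, q₁, q₂, q₃, q₄⟩ := hkeep s' hs'
    obtain ⟨r₁, r₂, r₃⟩ := flood_run (O := O) (n := n) (end₀ := end₀) (end₁ := end₁) q₁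
      (by rwa [q₂]) (by rwa [q₃]) (s' := p.run O s') rfl
    have hX' : s'.storedSet 5 m = X := Memory.storedSet_congr q₄ m
    rw [hX'] at r₂ r₃
    have hset : reached n ((p.run O s').setVar 12 (t + 1)) = reached n (p.run O s') := rfl
    rw [hset]
    refine ⟨r₁ ih₁, fun S hS hoS => r₂ S hS (ih₂ S hS hoS), ?_⟩
    by_cases heq : reached n (p.run O s') = reached n s'
    · left
      rw [heq]
      exact r₃ heq
    · right
      rcases ih₃ with ih₃ | ih₃
      · exact absurd (subset_antisymm (r₂ _ ih₃ subset_rfl) r₁) heq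
      · have := Set.ncard_lt_ncard (r₁.ssubset_of_ne (Ne.symm heq)) (Set.toFinite _)
        omega
  have hcl' : EdgeClosed end₀ end₁ X (reached n s₂) := by
    refine hcl.resolve_right fun hle => ?_
    have := Set.ncard_le_card (reached n s₂)
    simp only [Nat.card_eq_fintype_card, Fintype.card_fin] at this
    omega
  have hiff : ConnectedOff end₀ end₁ X ↔ ∀ a : Fin n, a ∈ reached n s₂ := by
    constructor
    · exact fun h => Set.eq_univ_iff_forall.1 (h _ ⟨o, ho⟩ hcl')
    · intro h S ⟨a, ha⟩ hS
      by_cases hoS : o ∈ S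
      · exact Set.eq_univ_of_forall fun b => hmin S hS hoS (h b)
      · exact absurd ha (hmin Sᶜ hS.compl hoS (h a))
  have hs₂0 : s₂.var 0 = n := (hkeep s₂ (run_agreeOff (.forTo 12 0 p) s₁)).1
  set q : ForProg := .ite (.read 6 (.var 12)) .skip (.assign 11 (.const 0)) with hq
  have hfin := run_forTo (O := O) (i := 12) (r := 0) (p := q) (s := s₂.setVar 11 1)
    (fun k s' => (s'.var 11 = 0 ∧ ∃ a : Fin n, (a : ℕ) < k ∧ a ∉ reached n s₂) ∨
      (s'.var 11 = 1 ∧ ∀ a : Fin n, (a : ℕ) < k → a ∈ reached n s₂)) ?_ ?_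
  · have hrun : connectedTest.run O s = (ForProg.forTo 12 0 q).run O (s₂.setVar 11 1) := rfl
    have h0 : (s₂.setVar 11 1).var 0 = n := by simpa using hs₂0
    rw [h0] at hfin
    rw [hrun, hiff]
    rcases hfin with ⟨h, a, -, ha⟩ | ⟨h, hall⟩
    · exact ⟨fun h' => absurd (h' a) ha, fun _ => h⟩
    · exact ⟨fun _ => h, fun h' => absurd (fun a => hall a a.2) h'⟩
  · exact Or.inr ⟨by simp, fun a ha => absurd ha (by omega)⟩
  intro k hk s' hs'12 hs' ih
  have hkn : k < n := by simpa [hs₂0] using hk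
  have h6 : s'.arr 6 = s₂.arr 6 := hs'.2 6 (by simp [hq, arrs])
  have hmem : (⟨k, hkn⟩ : Fin n) ∈ reached n s₂ ↔ s₂.arr 6 k ≠ 0 := Iff.rfl
  rw [hq, run]
  by_cases hk6 : s₂.arr 6 k = 0
  · rw [if_neg (by simp [Expr.eval, hs'12, h6, hk6])]
    exact Or.inl ⟨by simp [run, Expr.eval], ⟨k, hkn⟩, by simp, by rw [hmem]; simpa using hk6⟩
  · rw [if_pos (by simpa [Expr.eval, hs'12, h6] using hk6)]
    refine ih.imp (fun ⟨h, a, ha, hr⟩ => ⟨by simpa [run] using h, a, by omega, hr⟩)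
      fun ⟨h, hall⟩ => ⟨by simpa [run] using h, fun a ha => ?_⟩
    rcases Nat.lt_succ_iff_lt_or_eq.1 ha with ha | ha
    · exact hall a ha
    · obtain rfl : a = ⟨k, hkn⟩ := Fin.ext ha
      exact hmem.2 hk6

theorem isIndepTest_connectedTest (hpos : 0 < n) (hconn : ConnectedOff end₀ end₁ ∅) :
    IsIndepTest O (cycleMatroid end₀ end₁)✶ 1 (graphInput n m end₀ end₁) connectedTest where
  wf := by simp [connectedTest, floodStep, fill, WellFormed, regs]
  regs := by simp [connectedTest, floodStep, fill, regs]
  arrs := by simp [connectedTest, floodStep, fill, arrs]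
  sz_lt := by omega
  mem_ground j := by
    simp [cycleMatroid, graphInput]
  test s hs ha := by
    have hm : s.var 1 = m := by rw [hs 1 (by omega)]; simp [graphInput]
    have hX : s.storedSet 5 (s.var 1) ⊆ Set.Iio m := fun j hj => hm ▸ hj.1
    rw [cycleMatroid_dual_indep_iff hconn hX, hm]
    refine connectedTest_run ?_ hpos hm ?_ ?_
    · rw [hs 0 (by omega)]; simp [graphInput]
    · intro j
      rw [ha 0 (by omega)]
      simp [graphInput]
    · intro j
      rw [ha 1 (by omega)]
      simp [graphInput]

theorem oracleFree_partition_connectedTest : (partition 1 connectedTest).compile.OracleFree := by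
  simp [partition, insertElement, augment, search, findSink, expand, trySink, tryArc, testSet,
    fill, connectedTest, floodStep, compile, Prog.OracleFree]

end ForProg

end Courteous

namespace Courteous

/-! ## Color-avoiding connected colorings of graphs -/

section Paths

variable {α β : Type*} {G : Graph α β} {u v w : α} {e : β} {p : List (β × α)}

theorem IsPath.exists_of_mem (hp : IsPath G w p v) (hu : u ∈ w :: p.map Prod.snd) :
    ∃ q, IsPath G u q v := by
  obtain ⟨hwalk, hnodup⟩ := hp
  induction hwalk with
  | nil hw =>
    obtain rfl : u = _ := by simpa using hu
    exact ⟨[], .nil hw, by simp⟩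
  | cons hlink hwalk ih =>
    rcases List.mem_cons.1 hu with rfl | hu
    · exact ⟨_, .cons hlink hwalk, hnodup⟩
    · exact ih (by simpa using hu) (List.nodup_cons.1 hnodup).2

/-- Either `u` is already on the path, and a final segment starts there, or the edge can be put in
front without repeating a vertex. -/
theorem IsPath.exists_cons (hp : IsPath G w p v) (h : G.IsLink e u w) :
    ∃ q, IsPath G u q v := by
  by_cases hu : u ∈ w :: p.map Prod.snd
  · exact hp.exists_of_mem hu
  · exact ⟨(e, w) :: p, .cons h hp.1, List.nodup_cons.2 ⟨hu, hp.2⟩⟩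

theorem IsWalk.deleteEdges (h : IsWalk G u p v) {F : Set β} (hF : ∀ e ∈ p.map Prod.fst, e ∉ F) :
    IsWalk (G.deleteEdges F) u p v := by
  induction h with
  | nil hu => exact .nil hu
  | cons hlink _ ih =>
    exact .cons ⟨hlink, hF _ (by simp)⟩ (ih fun e he => hF e (by simp at he ⊢; tauto))

/-- At most one edge is removed, and it lies on at most one of two edge-disjoint paths, so the other
one survives. -/
theorem EdgeConnected.connected_deleteEdges (h : EdgeConnected G 2) {F : Set β}
    (hF : F.Subsingleton) : Connected (G.deleteEdges F) := by
  rcases h with ⟨hnt, h⟩ | ⟨h, -⟩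
  · refine ⟨hnt.nonempty, fun u hu v hv => ?_⟩
    by_cases huv : u = v
    · subst huv
      exact ⟨[], .nil hu, by simp⟩
    obtain ⟨P, hP, hdisj⟩ := h u hu v hv huv
    by_cases h₀ : ∀ e ∈ (P 0).map Prod.fst, e ∉ F
    · exact ⟨P 0, (hP 0).1.deleteEdges h₀, (hP 0).2⟩
    · push Not at h₀
      obtain ⟨e, he, heF⟩ := h₀
      refine ⟨P 1, (hP 1).1.deleteEdges fun e' he' heF' => ?_, (hP 1).2⟩
      rw [hF heF' heF] at he'
      exact hdisj 0 1 (by simp) he he'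
  · obtain ⟨x, hx⟩ := Set.encard_eq_one.1 h
    refine ⟨⟨x, by simpa using hx.ge⟩, fun u hu v hv => ?_⟩
    have hu' : u ∈ G.vertexSet := hu
    have hv' : v ∈ G.vertexSet := hv
    rw [hx, Set.mem_singleton_iff] at hu' hv'
    subst hu' hv'
    exact ⟨[], .nil hu, by simp⟩

end Paths

/-! ### From graphs to numbered graphs -/

section Numbering

variable {α β : Type*} {G : Graph α β} {n m : ℕ} {labV : Fin n ≃ G.vertexSet}
  {labE : Fin m ≃ G.edgeSet} {end₀ end₁ : Fin m → Fin n}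

/-- A path cannot leave a closed set, which gives one direction. For the other, the vertices from
which `v` can be reached form a closed set. -/
theorem connected_deleteEdges_iff
    (hends : ∀ i, G.IsLink (labE i) (labV (end₀ i)) (labV (end₁ i))) (hpos : 0 < n) {F : Set β} :
    Connected (G.deleteEdges F) ↔
      ConnectedOff end₀ end₁ {i | ∃ h : i < m, (labE ⟨i, h⟩ : β) ∈ F} := by
  set X : Set ℕ := {i | ∃ h : i < m, (labE ⟨i, h⟩ : β) ∈ F} with hX
  have hmem : ∀ i : Fin m, (i : ℕ) ∉ X ↔ (labE i : β) ∉ F := fun i => by simp [hX]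
  constructor
  · rintro ⟨-, hconn⟩ S ⟨a, ha⟩ hS
    refine Set.eq_univ_of_forall fun b => ?_
    obtain ⟨p, hp, -⟩ := hconn (labV a) (labV a).2 (labV b) (labV b).2
    have hwalk : ∀ {u p v}, IsWalk (G.deleteEdges F) u p v →
        (∀ a, (labV a : α) = u → a ∈ S) → ∀ b, (labV b : α) = v → b ∈ S := by
      intro u p v h
      induction h with
      | nil => exact id
      | @cons u w v e p hlink _ ih =>
        refine fun hu => ih fun c hc => ?_
        obtain ⟨hlink, heF⟩ := hlink
        obtain ⟨i, hi⟩ := labE.surjective ⟨e, hlink.edge_mem⟩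
        have hie : (labE i : β) = e := by rw [hi]
        have hends' := hends i
        have hcl := hS i ((hmem i).2 (by rwa [hie]))
        rw [hie] at hends'
        -- The walk may traverse the edge in either direction relative to the recorded order of its
        -- ends.
        rcases hends'.eq_and_eq_or_eq_and_eq hlink with ⟨h₁, h₂⟩ | ⟨h₁, h₂⟩
        · have := labV.injective (Subtype.ext (hc.trans h₂.symm))
          rw [this, ← hcl]
          exact hu _ h₁
        · have := labV.injective (Subtype.ext (hc.trans h₁.symm))
          rw [this, hcl]
          exact hu _ h₂
    exact hwalk hp (fun a' ha' => labV.injective (Subtype.ext ha') ▸ ha) b rfl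
  · intro h
    refine ⟨⟨labV ⟨0, hpos⟩, (labV ⟨0, hpos⟩).2⟩, fun u hu v hv => ?_⟩
    have huniv := h {a | ∃ p, IsPath (G.deleteEdges F) (labV a) p v}
      ⟨labV.symm ⟨v, hv⟩, [], by simpa using .nil hv, by simp⟩ fun i hi => ?_
    · obtain ⟨p, hp⟩ := (Set.eq_univ_iff_forall.1 huniv) (labV.symm ⟨u, hu⟩)
      exact ⟨p, by simpa using hp⟩
    have hlink : (G.deleteEdges F).IsLink (labE i) (labV (end₀ i)) (labV (end₁ i)) :=
      ⟨hends i, (hmem i).1 hi⟩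
    exact ⟨fun ⟨p, hp⟩ => hp.exists_cons hlink.symm, fun ⟨p, hp⟩ => hp.exists_cons hlink⟩

theorem exists_exec_isMinColorAvoiding
    (hends : ∀ i, G.IsLink (labE i) (labV (end₀ i)) (labV (end₁ i))) (hG : EdgeConnected G 2) :
    ∃ t s, Exec (fun _ => False) (ForProg.partition 1 ForProg.connectedTest).compile
      (graphInput n m end₀ end₁) t s ∧
      t ≤ (ForProg.partition 1 ForProg.connectedTest).cost.eval (n + m) ∧
      IsMinColorAvoiding G 1 (fun x => s.arr 0 (labE.symm x)) := by
  have hpos : 0 < n := by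
    obtain ⟨x, hx⟩ := (hG.connected_deleteEdges Set.subsingleton_empty).1
    exact (labV.symm ⟨x, hx⟩).pos
  have hconn : ∀ F : Set β, F.Subsingleton →
      ConnectedOff end₀ end₁ {i | ∃ h : i < m, (labE ⟨i, h⟩ : β) ∈ F} := fun F hF =>
    (connected_deleteEdges_iff hends hpos).1 (hG.connected_deleteEdges hF)
  have hconn₀ : ConnectedOff end₀ end₁ ∅ := by simpa using hconn ∅ Set.subsingleton_empty
  set L := cycleMatroid end₀ end₁ with hL
  have hLE : L✶.E = Set.Iio m := rfl
  have hLfin : L.Finite := ⟨Set.finite_Iio m⟩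
  -- Removing a single edge keeps the graph connected, so the dual of the cycle matroid has no
  -- loops.
  have hloop : ∀ i ∈ L✶.E, L✶.Indep {i} := by
    intro i hi
    have hi' : i < m := hi
    rw [cycleMatroid_dual_indep_iff hconn₀ (by simpa using hi')]
    refine (hconn {(labE ⟨i, hi'⟩ : β)} Set.subsingleton_singleton).anti ?_
    rintro _ rfl
    exact ⟨hi', rfl⟩
  obtain ⟨t, s, hexec, ht, hind, hneed⟩ :=
    (ForProg.isIndepTest_connectedTest (O := fun _ => False) hpos hconn₀).exists_exec_partition
      hloop (by simp [graphInput]) (by simp [graphInput]) (n := n + m) (by simp [graphInput])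
      (by simp [graphInput])
  refine ⟨t, s, hexec, ht, minimal_of_needsColors (N := L✶) hLE labE (fun f => ?_) hind hneed⟩
  have hiff : ∀ c, L✶.Indep {i | ∃ h : i < m, f (labE ⟨i, h⟩) = c} ↔
      Connected (G.deleteEdges (Subtype.val '' (f ⁻¹' {c}))) := by
    intro c
    rw [cycleMatroid_dual_indep_iff hconn₀ (by rintro i ⟨hi, -⟩; exact hi),
      connected_deleteEdges_iff hends hpos]
    convert Iff.rfl using 2
    ext i
    simp
  constructor
  · intro h c
    rw [hiff]
    simpa using h {c} (by simp)
  · intro h D hD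
    -- The empty set of colors requires that the graph itself be connected, which does not depend on
    -- the coloring.
    rcases D.eq_empty_or_nonempty with rfl | ⟨c, hc⟩
    · simpa using hG.connected_deleteEdges Set.subsingleton_empty
    · have hDc : D = {c} := Finset.eq_singleton_iff_unique_mem.2
        ⟨hc, fun d hd => Finset.card_le_one.1 hD d hd c hc⟩
      rw [hDc, Finset.coe_singleton]
      exact (hiff c).1 (h c)

end Numbering

end Courteous

theorem theorem3p6 :
    -- one program and one polynomial bound serve all bridgeless matroids
    (∃ (p : Courteous.Prog) (T : Polynomial ℕ),
      ∀ (α : Type*) (M : Matroid α) (n : ℕ) (lab : Fin n ≃ M.E), Courteous.Bridgeless M →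
        ∃ (t : ℕ) (s : Courteous.Memory),
          Courteous.Exec (Courteous.indepOracle M lab) p (Courteous.matroidInput n) t s ∧
          t ≤ T.eval n ∧
          -- cell `i` of array `0` contains the color of the `i`-th element
          Courteous.IsMinCourteous M 1 (fun x => s.arr 0 (lab.symm x))) ∧
    -- one program without oracle and one polynomial bound serve all 2-edge-connected graphs
    (∃ (p : Courteous.Prog) (T : Polynomial ℕ), p.OracleFree ∧
      ∀ (α : Type*) (β : Type*) (G : Graph α β) (n m : ℕ)
        (labV : Fin n ≃ G.vertexSet) (labE : Fin m ≃ G.edgeSet) (end₀ end₁ : Fin m → Fin n),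
        (∀ i, G.IsLink (labE i) (labV (end₀ i)) (labV (end₁ i))) →
        Courteous.EdgeConnected G 2 →
        ∃ (t : ℕ) (s : Courteous.Memory),
          Courteous.Exec (fun _ => False) p (Courteous.graphInput n m end₀ end₁) t s ∧
          t ≤ T.eval (n + m) ∧
          -- cell `i` of array `0` contains the color of the `i`-th edge
          Courteous.IsMinColorAvoiding G 1 (fun x => s.arr 0 (labE.symm x))) := by
  exact ⟨⟨_, _, fun _ _ _ lab hM => Courteous.exists_exec_isMinCourteous lab hM⟩,
    _, _, Courteous.ForProg.oracleFree_partition_connectedTest,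
    fun _ _ _ _ _ _ _ _ _ hends hG => Courteous.exists_exec_isMinColorAvoiding hends hG⟩
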